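/- Let $q$ be a prime power, $m=q^2+1$ and $P=q(q^2+1)$. A Steiner $(m,q+1,3)$ system is a collection of $(q+1)$-element subsets (blocks) of $\{1,\dots,m\}$ such that every $3$-element subset of $\{1,\dots,m\}$ lies in exactly one block. **Partition.** For a field $K$ with $q^2$ elements and its subfield $F$ with $q$ elements, the orbit of $F\cup\{\infty\}$ under the action of $\mathrm{PGL}_2(K)$ on $K\cup\{\infty\}$ (whose points are numbered $1,\dots,m$ in any way) is a Steiner $(q^2+1,q+1,3)$ system. Every Steiner $(q^2+1,q+1,3)$ system has exactly $P$ blocks. Let $R_1,\dots,R_P$ be the blocks of any such system. Then every triple $i>j>k$ in $\{1,\dots,m\}$ lies in $TB_3(R_p)=\{(i,j,k): i,j,k\in R_p,\ i>j>k\}$ for exactly one $p$. **Diagonal blocks.** There are sets $N_p$ of triples $(a,a,b)$ or $(a,b,b)$ with $a>b$ (non-central diagonal blocks) and sets $D_p$ of triples $(a,a,a)$ (central diagonal blocks), $1\le p\le P$, such that each such triple lies in exactly one $N_p$, respectively exactly one $D_p$; $|N_p|=q$ and $|D_p|\le 1$ for all $p$; and all entries of the triples in $N_p\cup D_p$ belong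 to $R_p$, so that processor $p$ needs no vector data besides what it needs for $TB_3(R_p)$. **Algorithm.** Let $n=(q^2+1)b$ with $q(q+1)\mid b$, and let $A\in\mathbb R^{n\times n\times n}$ be a symmetric tensor and $x\in\mathbb R^n$. Divide $\{1,\dots,n\}$ into $m$ contiguous parts of length $b$, and correspondingly $A$ into $b\times b\times b$ blocks $A[i][j][k]$ and $x$ and $y=A\times_2x\times_3x$ (that is, $y_i=\sum_{j,k}a_{ijk}x_jx_k$) into row blocks $x[i]$, $y[i]$. Let $Q_i=\{p: i\in R_p\}$. Each row block $i$ can be divided evenly among the processors in $Q_i$, that is, each of them owns $b/|Q_i|$ of its entries. For every such distribution (the same one for $x$ and $y$) each processor owns $n/P$ entries of each vector. Fix such a distribution and any sets $N_p,D_p$ as above, and consider the following algorithm, in which processor $p$ holds the blocks of $A$ indexed by $TB_3(R_p)\cup N_p\cup D_p$. 1. Gather: for all $p\ne r$ with $R_p\cap R_r\neq\emptyset$, processor $p$ sends to $r$ the entries of $x[i]$, $i\in R_p\cap R_r$, that $p$ owns. 2. Compute: each processor adds up the contributions of its blocks of $A$ to the row blocks of $y$. With $B=A[i][j][k]$, block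 $(i,j,k)$, $i>j>k$, contributes $2B\times_2x[j]\times_3x[k]$ to $y[i]$, $2B\times_1x[i]\times_3x[k]$ to $y[j]$ and $2B\times_1x[i]\times_2x[j]$ to $y[k]$. Block $(i,i,k)$, $i>k$, contributes $2B\times_2x[i]\times_3x[k]$ to $y[i]$ and $B\times_1x[i]\times_2x[i]$ to $y[k]$. Block $(i,k,k)$, $i>k$, contributes $B\times_2x[k]\times_3x[k]$ to $y[i]$ and $2B\times_1x[i]\times_2x[k]$ to $y[k]$. Block $(i,i,i)$ contributes $B\times_2x[i]\times_3x[i]$ to $y[i]$. 3. Reduce: for all $p\neq r$ with $R_p\cap R_r\neq\emptyset$, processor $p$ sends to $r$ its partial results for the entries of $y[i]$, $i\in R_p\cap R_r$, that $r$ owns, and $r$ adds them to its own. Each of the communication phases 1 and 3 has a point-to-point schedule, independent of $A$ and $x$, of exactly $$\frac{q^3}{2}+\frac{3q^2}{2}-1$$ steps, in each of which every processor sends at most one message and receives at most one message, such that: * after phase 1 each processor $p$ knows exactly the row blocks $x[i]$ with $i\in R_p$, and after phase 3 each entry of $y=A\times_2x\times_3x$ is at its owner; * in each of the two phases every processor sends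 exactly $n\frac{q+1}{q^2+1}-\frac nP$ words and receives the same number of words; * the bandwidth cost of the two phases together, i.e. the sum over all steps of the length of the longest message in the step, is $$2\left(\frac{n(q+1)}{q^2+1}-\frac{n}{P}\right).$$ **Comparison with the lower bound.** This cost and the lower bound $2\left(\frac{n(n-1)(n-2)}{P}\right)^{1/3}-\frac{2n}{P}$ have the same leading term $2n/P^{1/3}$: for every $\varepsilon>0$ there is a $q_0$ such that for all prime powers $q\ge q_0$ and all positive multiples $n$ of $q(q+1)(q^2+1)$, each of them differs from $2n/P^{1/3}$ by at most $\varepsilon\cdot 2n/P^{1/3}$, where $P=q(q^2+1)$. -/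

import Mathlib

noncomputable section

namespace STTSV

open scoped BigOperators Pointwise MatrixGroups

/-! ### Steiner systems and the spherical geometries -/

/-- `S` is a Steiner `(n, r, s)` system: a collection of `r`-element subsets (blocks) of an
`n`-element set such that every `s`-element subset lies in exactly one block. -/
def IsSteinerSystem (n r s : ℕ) (S : Set (Finset (Fin n))) : Prop :=
  (∀ B ∈ S, B.card = r) ∧ ∀ X : Finset (Fin n), X.card = s → ∃! B, B ∈ S ∧ X ⊆ B

/-- The subset `F ∪ {∞}` of the projective line `K ∪ {∞}`, for a subfield `F` of `K`. -/
def subline {K : Type*} [Field K] (F : Subfield K) : Set (OnePoint K) :=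
  insert OnePoint.infty ((fun a : K => (a : OnePoint K)) '' (F : Set K))

open Classical in
/-- The orbit of `F ∪ {∞}` under the Möbius transformations of `K ∪ {∞}`, the points being numbered
by `e`. (Scalar matrices act trivially, so the orbits of `GL₂(K)` are those of `PGL₂(K)`.) -/
def sphericalSystem {K : Type*} [Field K] (F : Subfield K) {n : ℕ} (e : OnePoint K ≃ Fin n) :
    Set (Finset (Fin n)) :=
  {B | ∃ L ∈ MulAction.orbit (GL (Fin 2) K) (subline F), (B : Set (Fin n)) = e '' L}

/-! ### Blocks of the lower tetrahedron and their assignment to processors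

`m` is the number of row blocks, `P` the number of processors, `b` the length of a row block. -/

/-- Index `(i, j, k)` of a block of a tensor whose dimensions are divided into `m` parts. -/
abbrev BlockIndex (m : ℕ) := Fin m × Fin m × Fin m

/-- The off-diagonal blocks of the lower tetrahedron: `i > j > k`. -/
def offDiagonal (m : ℕ) : Finset (BlockIndex m) :=
  Finset.univ.filter fun t => t.2.1 < t.1 ∧ t.2.2 < t.2.1

/-- The non-central diagonal blocks `(a, a, b)` and `(a, b, b)` with `a > b`. -/
def nonCentral (m : ℕ) : Finset (BlockIndex m) :=
  Finset.univ.filter fun t => (t.1 = t.2.1 ∧ t.2.2 < t.2.1) ∨ (t.2.1 < t.1 ∧ t.2.1 = t.2.2)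

/-- The central diagonal blocks `(i, i, i)`. -/
def central (m : ℕ) : Finset (BlockIndex m) :=
  Finset.univ.filter fun t => t.1 = t.2.1 ∧ t.2.1 = t.2.2

/-- The blocks that involve only row blocks in `R`. -/
def Within {m : ℕ} (R : Finset (Fin m)) (t : BlockIndex m) : Prop :=
  t.1 ∈ R ∧ t.2.1 ∈ R ∧ t.2.2 ∈ R

/-- The tetrahedral block `TB₃(R) = {(i, j, k) | i, j, k ∈ R, i > j > k}`. -/
def tetra {m : ℕ} (R : Finset (Fin m)) : Finset (BlockIndex m) :=
  (offDiagonal m).filter fun t => t.1 ∈ R ∧ t.2.1 ∈ R ∧ t.2.2 ∈ R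

/-- The sets `N p` and `D p` form an assignment of the non-central and central diagonal blocks to
the processors: every such block goes to exactly one processor, every processor gets `q` non-central
and at most one central diagonal block, and the blocks of processor `p` involve only the row blocks
in `R p`, which `p` requires for its off-diagonal blocks anyway. -/
structure IsDiagonalAssignment {m P : ℕ} (q : ℕ) (R : Fin P → Finset (Fin m))
    (N D : Fin P → Finset (BlockIndex m)) : Prop where
  nonCentral_subset : ∀ p, N p ⊆ nonCentral m
  central_subset : ∀ p, D p ⊆ central m
  nonCentral_unique : ∀ t ∈ nonCentral m, ∃! p, t ∈ N p
  central_unique : ∀ t ∈ central m, ∃! p, t ∈ D p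
  nonCentral_card : ∀ p, (N p).card = q
  central_card : ∀ p, (D p).card ≤ 1
  nonCentral_within : ∀ p, ∀ t ∈ N p, Within (R p) t
  central_within : ∀ p, ∀ t ∈ D p, Within (R p) t

/-- `Q_i`, the set of processors that require row block `i`. -/
def rowProcs {m P : ℕ} (R : Fin P → Finset (Fin m)) (i : Fin m) : Finset (Fin P) :=
  Finset.univ.filter fun p => i ∈ R p

/-- Entry `s` of row block `i` of either vector is owned by processor `owner i s`; row block `i` is
divided evenly among the processors in `Q_i`, each owning `b / |Q_i|` entries of it. -/
def IsEvenDistribution {m P b : ℕ} (R : Fin P → Finset (Fin m))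
    (owner : Fin m → Fin b → Fin P) : Prop :=
  (∀ i s, owner i s ∈ rowProcs R i) ∧
  ∀ i, ∀ p ∈ rowProcs R i,
    (Finset.univ.filter fun s => owner i s = p).card * (rowProcs R i).card = b

/-! ### Tensors, vectors, and their blocks -/

/-- A symmetric `3`-dimensional tensor. -/
def IsSymmetricTensor {n : ℕ} (A : Fin n → Fin n → Fin n → ℝ) : Prop :=
  ∀ i j k, A i j k = A j i k ∧ A i j k = A i k j

/-- `y = A ×₂ x ×₃ x`. -/
def sttsv {n : ℕ} (A : Fin n → Fin n → Fin n → ℝ) (x : Fin n → ℝ) : Fin n → ℝ :=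
  fun i => ∑ j, ∑ k, A i j k * x j * x k

/-- The `s`-th index of the `i`-th of the `m` contiguous parts, of length `b`, of the `n = m * b`
indices: it is number `i * b + s`, counting from `0`. -/
def entry {m b n : ℕ} (h : n = m * b) (i : Fin m) (s : Fin b) : Fin n :=
  Fin.cast h.symm (finProdFinEquiv (i, s))

/-- The `b × b × b` block of `A` with index `t`. -/
def tensorBlock {m b n : ℕ} (h : n = m * b) (A : Fin n → Fin n → Fin n → ℝ) (t : BlockIndex m) :
    Fin b → Fin b → Fin b → ℝ :=
  fun s u v => A (entry h t.1 s) (entry h t.2.1 u) (entry h t.2.2 v)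

/-- `B ×₂ y ×₃ z`. -/
def mul23 {b : ℕ} (B : Fin b → Fin b → Fin b → ℝ) (y z : Fin b → ℝ) : Fin b → ℝ :=
  fun s => ∑ u, ∑ v, B s u v * y u * z v

/-- `B ×₁ y ×₃ z`. -/
def mul13 {b : ℕ} (B : Fin b → Fin b → Fin b → ℝ) (y z : Fin b → ℝ) : Fin b → ℝ :=
  fun u => ∑ s, ∑ v, B s u v * y s * z v

/-- `B ×₁ y ×₂ z`. -/
def mul12 {b : ℕ} (B : Fin b → Fin b → Fin b → ℝ) (y z : Fin b → ℝ) : Fin b → ℝ :=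
  fun v => ∑ s, ∑ u, B s u v * y s * z u

/-- What the block `B` with index `(i, j, k)`, `i ≥ j ≥ k`, of a symmetric tensor contributes to the
row blocks of `y`, computed from the row blocks `i, j, k` of `x`. -/
def blockUpdate {m b : ℕ} (B : Fin b → Fin b → Fin b → ℝ) (t : BlockIndex m)
    (x : Fin m → Fin b → ℝ) : Fin m → Fin b → ℝ :=
  let i := t.1
  let j := t.2.1
  let k := t.2.2
  if i ≠ j ∧ j ≠ k then
    Pi.single i ((2 : ℝ) • mul23 B (x j) (x k)) + Pi.single j ((2 : ℝ) • mul13 B (x i) (x k))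
      + Pi.single k ((2 : ℝ) • mul12 B (x i) (x j))
  else if i = j ∧ j ≠ k then
    Pi.single i ((2 : ℝ) • mul23 B (x i) (x k)) + Pi.single k (mul12 B (x i) (x i))
  else if i ≠ j ∧ j = k then
    Pi.single i (mul23 B (x k) (x k)) + Pi.single k ((2 : ℝ) • mul12 B (x i) (x k))
  else
    Pi.single i (mul23 B (x i) (x i))

/-! ### Point-to-point communication -/

/-- A communication step: `src r = some p` means that `r` receives a message from `p`, and
`src r = none` that `r` receives nothing. So every processor receives at most one message. -/
abbrev CommStep (P : ℕ) := Fin P → Option (Fin P)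

/-- In every step, no processor sends more than one message, and none sends one to itself. -/
def IsSchedule {P : ℕ} (σ : List (CommStep P)) : Prop :=
  ∀ src ∈ σ, (∀ r r' p, src r = some p → src r' = some p → r = r') ∧ ∀ r, src r ≠ some r

/-- A vector entry, given by its row block and its position therein. -/
abbrev Word (m b : ℕ) := Fin m × Fin b

/-- The message from `p` to `r` when `x` is gathered: the portions owned by `p` of the row blocks
that `r` also requires. -/
def gatherMsg {m P b : ℕ} (R : Fin P → Finset (Fin m)) (owner : Fin m → Fin b → Fin P)
    (p r : Fin P) : Finset (Word m b) :=
  Finset.univ.filter fun w => w.1 ∈ R p ∧ w.1 ∈ R r ∧ owner w.1 w.2 = p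

/-- The message from `p` to `r` when `y` is reduced: the partial results of `p` for the portions
owned by `r` of the row blocks that they both require. -/
def reduceMsg {m P b : ℕ} (R : Fin P → Finset (Fin m)) (owner : Fin m → Fin b → Fin P)
    (p r : Fin P) : Finset (Word m b) :=
  Finset.univ.filter fun w => w.1 ∈ R p ∧ w.1 ∈ R r ∧ owner w.1 w.2 = r

section Cost

variable {m P b : ℕ} (msg : Fin P → Fin P → Finset (Word m b))

/-- Number of words that `p` sends in a step, `msg p r` being the message from `p` to `r`. -/
def sentInStep (src : CommStep P) (p : Fin P) : ℕ :=
  ∑ r, if src r = some p then (msg p r).card else 0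

/-- Number of words that `r` receives in a step. -/
def receivedInStep (src : CommStep P) (r : Fin P) : ℕ :=
  (src r).elim 0 fun p => (msg p r).card

/-- Total number of words that `p` sends. -/
def wordsSent (σ : List (CommStep P)) (p : Fin P) : ℕ :=
  (σ.map fun src => sentInStep msg src p).sum

/-- Total number of words that `p` receives. -/
def wordsReceived (σ : List (CommStep P)) (p : Fin P) : ℕ :=
  (σ.map fun src => receivedInStep msg src p).sum

/-- Bandwidth cost: a step costs as much as the longest message that is transferred in it. -/
def bandwidthCost (σ : List (CommStep P)) : ℕ :=
  (σ.map fun src => Finset.univ.sup fun r => receivedInStep msg src r).sum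

end Cost

/-! ### The parallel algorithm -/

section Algorithm

variable {m P b n : ℕ} (h : n = m * b) (R : Fin P → Finset (Fin m))
  (owner : Fin m → Fin b → Fin P)

/-- The entries of `x` known to each processor initially: those it owns. -/
def initialX (x : Fin n → ℝ) : Fin P → Fin m → Fin b → Option ℝ :=
  fun p i s => if owner i s = p then some (x (entry h i s)) else none

/-- A step of gathering: the receiver stores what the sender has in memory at the entries that make
up the message. -/
def gatherStep (X : Fin P → Fin m → Fin b → Option ℝ) (src : CommStep P) :
    Fin P → Fin m → Fin b → Option ℝ :=
  fun r i s => (src r).elim (X r i s) fun p =>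
    if (i, s) ∈ gatherMsg R owner p r then X p i s else X r i s

/-- The entries of `x` known to each processor after gathering with the schedule `σ`. -/
def gatherX (σ : List (CommStep P)) (x : Fin n → ℝ) : Fin P → Fin m → Fin b → Option ℝ :=
  σ.foldl (gatherStep R owner) (initialX h owner x)

/-- The local computations: processor `p` adds up the contributions of its blocks `T p` of the
tensor, reading `x` from its memory. -/
def localY (T : Fin P → Finset (BlockIndex m)) (A : Fin n → Fin n → Fin n → ℝ)
    (X : Fin P → Fin m → Fin b → Option ℝ) : Fin P → Fin m → Fin b → ℝ :=
  fun p => ∑ t ∈ T p, blockUpdate (tensorBlock h A t) t fun i s => (X p i s).getD 0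

/-- Every processor starts the reduction with its own partial result for the entries it owns. -/
def initialY (Y : Fin P → Fin m → Fin b → ℝ) : Fin P → Fin m → Fin b → ℝ :=
  fun p i s => if owner i s = p then Y p i s else 0

/-- A step of the reduction: the receiver adds the partial results of the sender to its own. -/
def reduceStep (Y : Fin P → Fin m → Fin b → ℝ) (Z : Fin P → Fin m → Fin b → ℝ)
    (src : CommStep P) : Fin P → Fin m → Fin b → ℝ :=
  fun r i s => Z r i s + (src r).elim 0 fun p =>
    if (i, s) ∈ reduceMsg R owner p r then Y p i s else 0

/-- The outcome of reducing the partial results `Y` with the schedule `τ`. -/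
def reduceY (τ : List (CommStep P)) (Y : Fin P → Fin m → Fin b → ℝ) :
    Fin P → Fin m → Fin b → ℝ :=
  τ.foldl (reduceStep R owner Y) (initialY owner Y)

/-- The outcome of the whole algorithm: gather `x` with `σ`, compute locally with the tensor blocks
`TB₃(R p) ∪ N p ∪ D p`, and reduce `y` with `τ`. -/
def parallelSTTSV (N D : Fin P → Finset (BlockIndex m)) (σ τ : List (CommStep P))
    (A : Fin n → Fin n → Fin n → ℝ) (x : Fin n → ℝ) : Fin P → Fin m → Fin b → ℝ :=
  reduceY R owner τ
    (localY h (fun p => tetra (R p) ∪ N p ∪ D p) A (gatherX h R owner σ x))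

end Algorithm

/-! ### Costs -/

/-- `n (q + 1) / (q² + 1) - n / P` with `P = q (q² + 1)`. -/
def costPerVector (q n : ℕ) : ℝ :=
  (n : ℝ) * (q + 1) / ((q : ℝ) ^ 2 + 1) - (n : ℝ) / ((q : ℝ) * ((q : ℝ) ^ 2 + 1))

/-- `2 (n (n - 1) (n - 2) / P) ^ (1 / 3) - 2 n / P`, the lower bound for the communication of
parallel atomic algorithms. -/
def lowerBound (n P : ℕ) : ℝ :=
  2 * ((n : ℝ) * ((n : ℝ) - 1) * ((n : ℝ) - 2) / (P : ℝ)) ^ (1 / 3 : ℝ) - 2 * ((n : ℝ) / (P : ℝ))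

/-- `2 n / P ^ (1 / 3)`. -/
def leadingTerm (n P : ℕ) : ℝ := 2 * (n : ℝ) / (P : ℝ) ^ (1 / 3 : ℝ)

end STTSV

end

/-!
A Steiner `(q² + 1, q + 1, 3)` system is an inversive plane of order `q`. Double counting shows that
two points lie on `q + 1` common blocks, a point on `q (q + 1)` blocks, and that there are
`q (q² + 1)` blocks in all (`IsInversivePlane.card_pair`, `card_point`, `card_index`). Two blocks
have at most two points in common, and each block meets `q² (q + 1) / 2` others in two points and
`q² - 1` others in one (`two_mul_card_inter_eq_two`, `card_inter_eq_one`). The images of `F ∪ {∞}`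
form such a system because `GL₂(K)` is transitive on triples of distinct points, only the identity
fixes `0, 1, ∞`, and already `GL₂(F)` is transitive on the triples in `F ∪ {∞}`
(`isSteinerSystem_sphericalSystem`).

All else that has to be chosen comes from Hall's theorem. The relation between the non-central
diagonal blocks and `q` slots per processor is regular of degree `q (q + 1)`, so it has a perfect
matching; a central block is within reach of `q (q + 1)` processors, and a processor within reach of
only `q + 1` central blocks, so that these can go to distinct processors.
For `k = 1, 2`, the relation "`R p` and `R r` have exactly `k` points in common" is regular, so it is
a union of permutations (`exists_perm_decomposition`). These are the steps of the schedule, in number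
`q² (q + 1) / 2 + q² - 1`.

A message between processors with `k` common row blocks has `k b / (q (q + 1))` words, so that within
a step all messages are equally long, and the bandwidth cost is just the number of words that any one
processor receives (`IsExchange.bandwidthCost_eq`). That number is
`b / (q (q + 1)) * ∑ |R p ∩ R r| = b (q² + q - 1) / q`, the sum being over the `r ≠ p`.

The algorithm is correct because every processor hears exactly once from each processor with which it
shares a row block, so that the reduction adds up all partial results
(`IsExchange.reduceY_owner`); every block of the lower tetrahedron is held by exactly one processor;
and by symmetry of the tensor a block contributes what its permuted copies do to
`y_i = ∑ a_{ijk} x_j x_k` (`sum_blockUpdate`).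

For the comparison with the lower bound, note that `q ≤ P ^ (1 / 3) ≤ q + 1` and that the cube root of
`n (n - 1) (n - 2)` lies between `n - 2` and `n`, where `n ≥ q`.
-/

namespace STTSV

/-! ### Matchings in bipartite graphs -/

/-- A consequence of Hall's theorem: if every element on the left has at least `d > 0` neighbours
and every element on the right at most `d`, the left side can be matched into the right side. -/
theorem exists_injective_of_card_le {α β : Type*} [Fintype α] [Fintype β] [DecidableEq α]
    [DecidableEq β] (r : α → β → Prop) [∀ a b, Decidable (r a b)] {d : ℕ} (hd : 0 < d)
    (hl : ∀ a, d ≤ (Finset.univ.filter fun b => r a b).card)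
    (hr : ∀ b, (Finset.univ.filter fun a => r a b).card ≤ d) :
    ∃ f : α → β, Function.Injective f ∧ ∀ a, r a (f a) := by
  have hall := (Finset.all_card_le_biUnion_card_iff_exists_injective
    fun a => Finset.univ.filter fun b => r a b).1 fun s => by
      refine Nat.le_of_mul_le_mul_right (Finset.card_mul_le_card_mul r (m := d) (n := d) ?_ ?_) hd
      · intro a ha
        refine (hl a).trans (Finset.card_le_card fun b hb => ?_)
        simp only [Finset.mem_filter, Finset.mem_univ, true_and] at hb
        simp only [Finset.mem_bipartiteAbove, Finset.mem_biUnion, Finset.mem_filter,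
          Finset.mem_univ, true_and]
        exact ⟨⟨a, ha, hb⟩, hb⟩
      · intro b _
        refine (Finset.card_le_card fun a ha => ?_).trans (hr b)
        simpa using ((Finset.mem_bipartiteBelow r).1 ha).2
  obtain ⟨f, hf, h⟩ := hall
  exact ⟨f, hf, fun a => by simpa using h a⟩

/-- König's theorem on regular bipartite graphs: a `d`-regular relation is the disjoint union of the
graphs of `d` permutations. -/
theorem exists_perm_decomposition {α : Type*} [Fintype α] [DecidableEq α] (d : ℕ) :
    ∀ (r : α → α → Prop) [∀ a b, Decidable (r a b)],
      (∀ a, (Finset.univ.filter fun b => r a b).card = d) →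
      (∀ b, (Finset.univ.filter fun a => r a b).card = d) →
      ∃ l : List (Equiv.Perm α), l.length = d ∧
        ∀ a, ((l.map fun π => π a : List α) : Multiset α)
          = (Finset.univ.filter fun b => r a b).val := by
  induction d with
  | zero =>
    intro r _ hl _
    refine ⟨[], rfl, fun a => ?_⟩
    rw [Finset.card_eq_zero.1 (hl a)]
    rfl
  | succ d ih =>
    intro r _ hl hr
    obtain ⟨f, hf, hrf⟩ := exists_injective_of_card_le r (Nat.succ_pos d)
      (fun a => (hl a).ge) fun b => (hr b).le
    let π : Equiv.Perm α := Equiv.ofBijective f (Finite.injective_iff_bijective.1 hf)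
    have hπ : ∀ a, r a (π a) := hrf
    have key : ∀ a, (Finset.univ.filter fun b => r a b ∧ b ≠ π a)
        = (Finset.univ.filter fun b => r a b).erase (π a) := by
      intro a; ext b; simp [and_comm]
    have key' : ∀ b, (Finset.univ.filter fun a => r a b ∧ b ≠ π a)
        = (Finset.univ.filter fun a => r a b).erase (π.symm b) := by
      intro b; ext a
      simp [and_comm, Equiv.eq_symm_apply, eq_comm]
    obtain ⟨l, hl', h⟩ := ih (fun a b => r a b ∧ b ≠ π a)
      (fun a => by
        rw [key, Finset.card_erase_of_mem (by simpa using hπ a), hl]; rfl)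
      (fun b => by
        rw [key', Finset.card_erase_of_mem (by simpa using hπ (π.symm b)), hr]; rfl)
    refine ⟨π :: l, by simp [hl'], fun a => ?_⟩
    have ha := h a
    rw [key] at ha
    rw [List.map_cons, ← Multiset.cons_coe, ha, Finset.erase_val]
    exact Multiset.cons_erase (by simpa using hπ a)

/-! ### Counting in Steiner systems -/

/-- The sets `R p` are the blocks, without repetition, of a Steiner `(q² + 1, q + 1, 3)` system on
`V`, an inversive plane of order `q`. -/
structure IsInversivePlane {V ι : Type*} [Fintype V] (q : ℕ) (R : ι → Finset V) : Prop where
  two_le : 2 ≤ q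
  card_points : Fintype.card V = q ^ 2 + 1
  card_block : ∀ p, (R p).card = q + 1
  existsUnique_block : ∀ a b c, a ≠ b → a ≠ c → b ≠ c → ∃! p, a ∈ R p ∧ b ∈ R p ∧ c ∈ R p

namespace IsInversivePlane

variable {V ι : Type*} [Fintype V] [DecidableEq V] {q : ℕ} {R : ι → Finset V}
  (H : IsInversivePlane q R)
include H

theorem card_inter_le_two {p r : ι} (hpr : p ≠ r) : (R p ∩ R r).card ≤ 2 := by
  by_contra! h
  obtain ⟨a, b, c, ha, hb, hc, hab, hac, hbc⟩ := Finset.two_lt_card_iff.1 h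
  simp only [Finset.mem_inter] at ha hb hc
  exact hpr ((H.existsUnique_block a b c hab hac hbc).unique ⟨ha.1, hb.1, hc.1⟩
    ⟨ha.2, hb.2, hc.2⟩)

variable [Fintype ι]

theorem card_pair {a b : V} (hab : a ≠ b) :
    (Finset.univ.filter fun p => a ∈ R p ∧ b ∈ R p).card = q + 1 := by
  have hq := H.two_le
  have := Finset.card_mul_eq_card_mul (fun p c => c ∈ R p)
    (s := Finset.univ.filter fun p => a ∈ R p ∧ b ∈ R p) (t := (Finset.univ.erase a).erase b)
    (m := q - 1) (n := 1) ?_ ?_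
  · rw [Finset.card_erase_of_mem (by simp [hab.symm]), Finset.card_erase_of_mem (by simp),
      Finset.card_univ, H.card_points] at this
    refine Nat.eq_of_mul_eq_mul_right (show 0 < q - 1 by omega) (this.trans ?_)
    obtain ⟨k, rfl⟩ := Nat.exists_eq_add_of_le hq
    have h1 : 2 + k - 1 = k + 1 := by omega
    have h2 : (2 + k) ^ 2 + 1 - 1 - 1 = k ^ 2 + 4 * k + 3 := by
      have : (2 + k) ^ 2 = k ^ 2 + 4 * k + 4 := by ring
      omega
    rw [h1, h2]; ring
  · intro p hp
    simp only [Finset.mem_filter, Finset.mem_univ, true_and] at hp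
    have : Finset.bipartiteAbove (fun p c => c ∈ R p) ((Finset.univ.erase a).erase b) p
        = ((R p).erase a).erase b := by
      ext c; simp [Finset.mem_bipartiteAbove, and_assoc]
    rw [this, Finset.card_erase_of_mem (by simp [hab.symm, hp.2]), Finset.card_erase_of_mem hp.1,
      H.card_block]
    omega
  · intro c hc
    simp only [Finset.mem_erase, Finset.mem_univ, and_true] at hc
    obtain ⟨p, hp, hu⟩ := H.existsUnique_block a b c hab hc.2.symm hc.1.symm
    rw [Finset.card_eq_one]
    refine ⟨p, ?_⟩
    ext r
    simp only [Finset.mem_bipartiteBelow, Finset.mem_filter, Finset.mem_univ, true_and,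
      Finset.mem_singleton]
    exact ⟨fun h => hu r ⟨h.1.1, h.1.2, h.2⟩, fun h => h ▸ ⟨⟨hp.1, hp.2.1⟩, hp.2.2⟩⟩

theorem card_point (a : V) : (Finset.univ.filter fun p => a ∈ R p).card = q * (q + 1) := by
  have hq := H.two_le
  have := Finset.card_mul_eq_card_mul (fun p c => c ∈ R p)
    (s := Finset.univ.filter fun p => a ∈ R p) (t := Finset.univ.erase a)
    (m := q) (n := q + 1) ?_ ?_
  · rw [Finset.card_erase_of_mem (by simp), Finset.card_univ, H.card_points] at this
    refine Nat.eq_of_mul_eq_mul_right (show 0 < q by omega) (this.trans ?_)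
    rw [Nat.add_sub_cancel]; ring
  · intro p hp
    simp only [Finset.mem_filter, Finset.mem_univ, true_and] at hp
    have : Finset.bipartiteAbove (fun p c => c ∈ R p) (Finset.univ.erase a) p
        = (R p).erase a := by
      ext c; simp [Finset.mem_bipartiteAbove]
    rw [this, Finset.card_erase_of_mem hp, H.card_block]
    omega
  · intro c hc
    simp only [Finset.mem_erase, Finset.mem_univ, and_true] at hc
    rw [← H.card_pair hc.symm]
    congr 1
    ext r
    simp [Finset.mem_bipartiteBelow]

theorem card_index : Fintype.card ι = q * (q ^ 2 + 1) := by
  have := Finset.card_mul_eq_card_mul (fun p c => c ∈ R p)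
    (s := Finset.univ) (t := Finset.univ) (m := q + 1) (n := q * (q + 1))
    (fun p _ => by rw [← H.card_block p]; congr 1; ext; simp [Finset.mem_bipartiteAbove])
    (fun c _ => by rw [← H.card_point c]; congr 1)
  rw [Finset.card_univ, Finset.card_univ, H.card_points] at this
  refine Nat.eq_of_mul_eq_mul_right (show 0 < q + 1 by omega) (this.trans ?_)
  ring

variable [DecidableEq ι]

/-- Double counting of the pairs of a block and an ordered pair of distinct points of `R p` in it. -/
theorem two_mul_card_inter_eq_two (p : ι) :
    2 * (Finset.univ.filter fun r => p ≠ r ∧ (R p ∩ R r).card = 2).card = q ^ 2 * (q + 1) := by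
  have hsum : ∑ r ∈ Finset.univ.erase p, (R p ∩ R r).offDiag.card
      = ∑ x ∈ (R p).offDiag, q := by
    refine Eq.trans ?_ ((Finset.sum_card_bipartiteAbove_eq_sum_card_bipartiteBelow
      (fun r (x : V × V) => x.1 ∈ R r ∧ x.2 ∈ R r)
      (s := Finset.univ.erase p) (t := (R p).offDiag)).trans ?_)
    · refine Finset.sum_congr rfl fun r _ => congrArg _ ?_
      ext x
      simp only [Finset.mem_offDiag, Finset.mem_inter, Finset.mem_bipartiteAbove]
      tauto
    · refine Finset.sum_congr rfl fun x hx => ?_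
      rw [Finset.mem_offDiag] at hx
      have : (Finset.univ.erase p).bipartiteBelow (fun r (x : V × V) => x.1 ∈ R r ∧ x.2 ∈ R r) x
          = (Finset.univ.filter fun r => x.1 ∈ R r ∧ x.2 ∈ R r).erase p := by
        ext; simp [Finset.mem_bipartiteBelow]
      rw [this, Finset.card_erase_of_mem (by simp [hx.1, hx.2.1]), H.card_pair hx.2.2]
      rfl
  have hleft : ∑ r ∈ Finset.univ.erase p, (R p ∩ R r).offDiag.card
      = 2 * (Finset.univ.filter fun r => p ≠ r ∧ (R p ∩ R r).card = 2).card := by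
    have hfil : (Finset.univ.filter fun r => p ≠ r ∧ (R p ∩ R r).card = 2)
        = (Finset.univ.erase p).filter fun r => (R p ∩ R r).card = 2 := by
      ext; simp [eq_comm]
    rw [hfil, Finset.card_filter, Finset.mul_sum]
    refine Finset.sum_congr rfl fun r hr => ?_
    have h2 := H.card_inter_le_two (Finset.ne_of_mem_erase hr).symm
    rw [Finset.offDiag_card]
    generalize (R p ∩ R r).card = k at *
    interval_cases k <;> rfl
  rw [← hleft, hsum, Finset.sum_const, Finset.offDiag_card, H.card_block, smul_eq_mul]
  have : (q + 1) * (q + 1) - (q + 1) = q * (q + 1) := by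
    rw [Nat.sub_eq_iff_eq_add (by nlinarith)]; ring
  rw [this]; ring

theorem sum_card_inter (p : ι) :
    ∑ r ∈ Finset.univ.erase p, (R p ∩ R r).card = (q + 1) * (q ^ 2 + q - 1) := by
  refine Eq.trans ?_ ((Finset.sum_card_bipartiteAbove_eq_sum_card_bipartiteBelow
      (fun r x => x ∈ R r) (s := Finset.univ.erase p) (t := R p)).trans ?_)
  · refine Finset.sum_congr rfl fun r _ => congrArg _ ?_
    ext x
    simp [Finset.mem_bipartiteAbove]
  · rw [← H.card_block p, ← smul_eq_mul, ← Finset.sum_const]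
    refine Finset.sum_congr rfl fun x hx => ?_
    have : (Finset.univ.erase p).bipartiteBelow (fun r x => x ∈ R r) x
        = (Finset.univ.filter fun r => x ∈ R r).erase p := by
      ext; simp [Finset.mem_bipartiteBelow]
    rw [this, Finset.card_erase_of_mem (by simp [hx]), H.card_point]
    congr 1; ring

theorem card_inter_eq_one (p : ι) :
    (Finset.univ.filter fun r => p ≠ r ∧ (R p ∩ R r).card = 1).card = q ^ 2 - 1 := by
  have h2 := H.two_mul_card_inter_eq_two p
  have hs := H.sum_card_inter p
  have hleft : ∑ r ∈ Finset.univ.erase p, (R p ∩ R r).card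
      = (Finset.univ.filter fun r => p ≠ r ∧ (R p ∩ R r).card = 1).card
        + 2 * (Finset.univ.filter fun r => p ≠ r ∧ (R p ∩ R r).card = 2).card := by
    have hfil : ∀ k, (Finset.univ.filter fun r => p ≠ r ∧ (R p ∩ R r).card = k)
        = (Finset.univ.erase p).filter fun r => (R p ∩ R r).card = k := by
      intro k; ext; simp [eq_comm]
    rw [hfil, hfil, Finset.card_filter, Finset.card_filter, Finset.mul_sum,
      ← Finset.sum_add_distrib]
    refine Finset.sum_congr rfl fun r hr => ?_
    have h2 := H.card_inter_le_two (Finset.ne_of_mem_erase hr).symm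
    generalize (R p ∩ R r).card = k at *
    interval_cases k <;> rfl
  rw [hleft, h2] at hs
  have hq := H.two_le
  have h1 : 1 ≤ q ^ 2 := Nat.one_le_pow _ _ (by omega)
  zify [h1, show 1 ≤ q ^ 2 + q by omega] at hs ⊢
  linarith

end IsInversivePlane

/-- The blocks of a Steiner system in the sense of `IsSteinerSystem`, listed without repetition, form
an inversive plane. -/
theorem IsSteinerSystem.isInversivePlane {q : ℕ} {ι : Type*} (hq : 2 ≤ q)
    {R : ι → Finset (Fin (q ^ 2 + 1))} (hinj : Function.Injective R)
    (hS : IsSteinerSystem (q ^ 2 + 1) (q + 1) 3 (Set.range R)) : IsInversivePlane q R where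
  two_le := hq
  card_points := Fintype.card_fin _
  card_block p := hS.1 _ ⟨p, rfl⟩
  existsUnique_block a b c hab hac hbc := by
    obtain ⟨_, ⟨⟨p, rfl⟩, hp⟩, hu⟩ := hS.2 {a, b, c} (Finset.card_eq_three.2
      ⟨a, b, c, hab, hac, hbc, rfl⟩)
    refine ⟨p, by simpa [Finset.insert_subset_iff] using hp, fun r hr => hinj ?_⟩
    exact hu _ ⟨⟨r, rfl⟩, by simpa [Finset.insert_subset_iff] using hr⟩

theorem IsSteinerSystem.ncard_eq {q : ℕ} (hq : 2 ≤ q) {S : Set (Finset (Fin (q ^ 2 + 1)))}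
    (hS : IsSteinerSystem (q ^ 2 + 1) (q + 1) 3 S) : S.ncard = q * (q ^ 2 + 1) := by
  classical
  have H : IsInversivePlane q (Subtype.val : S → Finset (Fin (q ^ 2 + 1))) :=
    IsSteinerSystem.isInversivePlane hq Subtype.val_injective (by rwa [Subtype.range_coe])
  rw [← Nat.card_coe_set_eq, Nat.card_eq_fintype_card, H.card_index]

/-! ### The spherical geometries -/

open OnePoint in
/-- `GL₂` acts transitively on the triples of distinct points of the projective line. -/
theorem exists_smul_eq {K : Type*} [Field K] [DecidableEq K] {x y z : OnePoint K}
    (hxy : x ≠ y) (hxz : x ≠ z) (hyz : y ≠ z) :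
    ∃ g : GL (Fin 2) K, g • ((0 : K) : OnePoint K) = x ∧ g • ((1 : K) : OnePoint K) = y ∧
      g • (∞ : OnePoint K) = z := by
  -- the columns of the matrix represent `z` and `x`, scaled so that their sum represents `y`
  have mk : ∀ a b c d : K, a * d - b * c ≠ 0 → ∃ g : GL (Fin 2) K,
      g 0 0 = a ∧ g 0 1 = b ∧ g 1 0 = c ∧ g 1 1 = d := fun a b c d h =>
    ⟨Matrix.GeneralLinearGroup.mkOfDetNeZero !![a, b; c, d] (by simpa [Matrix.det_fin_two] using h),
      rfl, rfl, rfl, rfl⟩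
  induction x using OnePoint.rec with
  | infty =>
    induction y using OnePoint.rec with
    | infty => exact absurd rfl hxy
    | coe y =>
      induction z using OnePoint.rec with
      | infty => exact absurd rfl hxz
      | coe z =>
        have h : y - z ≠ 0 := sub_ne_zero.2 fun h => hyz (by rw [h])
        obtain ⟨g, h1, h2, h3, h4⟩ := mk z (y - z) 1 0 (by
          intro h'; apply h; linear_combination -h')
        refine ⟨g, ?_, ?_, ?_⟩ <;> simp [smul_some_eq_ite, smul_infty_eq_ite, h1, h2, h3, h4]
  | coe x =>
    induction y using OnePoint.rec with
    | infty =>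
      induction z using OnePoint.rec with
      | infty => exact absurd rfl hyz
      | coe z =>
        have h : x - z ≠ 0 := sub_ne_zero.2 fun h => hxz (by rw [h])
        obtain ⟨g, h1, h2, h3, h4⟩ := mk z (-x) 1 (-1) (by
          intro h'; apply h; linear_combination h')
        refine ⟨g, ?_, ?_, ?_⟩ <;> simp [smul_some_eq_ite, smul_infty_eq_ite, h1, h2, h3, h4]
    | coe y =>
      have h : y - x ≠ 0 := sub_ne_zero.2 fun h => hxy (by rw [h])
      induction z using OnePoint.rec with
      | infty =>
        obtain ⟨g, h1, h2, h3, h4⟩ := mk (y - x) x 0 1 (by simpa using h)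
        refine ⟨g, ?_, ?_, ?_⟩ <;> simp [smul_some_eq_ite, smul_infty_eq_ite, h1, h2, h3, h4]
      | coe z =>
        have h' : x - z ≠ 0 := sub_ne_zero.2 fun h => hxz (by rw [h])
        have h'' : z - y ≠ 0 := sub_ne_zero.2 fun h => hyz (by rw [h])
        obtain ⟨g, h1, h2, h3, h4⟩ := mk (z * (y - x)) (x * (z - y)) (y - x) (z - y) (by
          have : z * (y - x) * (z - y) - x * (z - y) * (y - x)
              = -((y - x) * (x - z) * (z - y)) := by ring
          rw [this]
          exact neg_ne_zero.2 (mul_ne_zero (mul_ne_zero h h') h''))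
        have hs : y - x + (z - y) ≠ 0 := by
          intro h0; apply h'; linear_combination -h0
        refine ⟨g, ?_, ?_, ?_⟩
        · simp [smul_some_eq_ite, h2, h4, h'']
        · simp only [smul_some_eq_ite, h1, h2, h3, h4, mul_one, if_neg hs]
          rw [OnePoint.coe_eq_coe, div_eq_iff hs]; ring
        · simp [smul_infty_eq_ite, h1, h3, h]

open OnePoint in
/-- A Möbius transformation that fixes `0`, `1` and `∞` is the identity. -/
theorem smul_eq_self_of_fixes {K : Type*} [Field K] [DecidableEq K] {g : GL (Fin 2) K}
    (h0 : g • ((0 : K) : OnePoint K) = (0 : K)) (h1 : g • ((1 : K) : OnePoint K) = (1 : K))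
    (hi : g • (∞ : OnePoint K) = ∞) (x : OnePoint K) : g • x = x := by
  rw [smul_infty_eq_self_iff] at hi
  have hdet : g 0 0 * g 1 1 ≠ 0 := by
    have := g.det_ne_zero
    rwa [Matrix.det_fin_two, hi, mul_zero, sub_zero] at this
  have hd : g 1 1 ≠ 0 := right_ne_zero_of_mul hdet
  simp only [smul_some_eq_ite, hi, zero_mul, zero_add, hd, if_false, mul_zero, mul_one,
    OnePoint.coe_eq_coe, div_eq_iff hd, one_mul] at h0 h1
  rw [h0, add_zero] at h1
  induction x using OnePoint.rec with
  | infty => exact smul_infty_eq_self_iff.2 hi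
  | coe x =>
    simp only [smul_some_eq_ite, hi, zero_mul, zero_add, hd, if_false, OnePoint.coe_eq_coe,
      div_eq_iff hd, h0, h1, add_zero]
    ring

open OnePoint in
theorem subline_eq_range_map {K : Type*} [Field K] (F : Subfield K) :
    subline F = Set.range (OnePoint.map F.subtype) := by
  ext x
  constructor
  · rintro (rfl | ⟨a, ha, rfl⟩)
    · exact ⟨∞, rfl⟩
    · exact ⟨((⟨a, ha⟩ : F) : OnePoint F), rfl⟩
  · rintro ⟨y, rfl⟩
    induction y using OnePoint.rec with
    | infty => exact Or.inl rfl
    | coe y => exact Or.inr ⟨y, y.2, rfl⟩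

open Classical in
open OnePoint Pointwise in
/-- The transformations with coefficients in `F` preserve `F ∪ {∞}`. -/
theorem map_smul_subline {K : Type*} [Field K] (F : Subfield K) (g : GL (Fin 2) F) :
    g.map F.subtype • subline F = subline F := by
  rw [subline_eq_range_map]
  ext x
  rw [Set.mem_smul_set]
  constructor
  · rintro ⟨_, ⟨y, rfl⟩, rfl⟩
    exact ⟨g • y, OnePoint.map_smul _ _ _⟩
  · rintro ⟨y, rfl⟩
    exact ⟨_, ⟨g⁻¹ • y, rfl⟩, by rw [← OnePoint.map_smul, smul_inv_smul]⟩

open Classical in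
open OnePoint Pointwise in
/-- The only image of `F ∪ {∞}` under a Möbius transformation that contains `0`, `1` and `∞` is
`F ∪ {∞}` itself: a transformation over `F` sends `0`, `1` and `∞` to their preimages under `g`, which
lie in `F ∪ {∞}`, and so it agrees with `g⁻¹`. -/
theorem smul_subline_eq_of_mem {K : Type*} [Field K] (F : Subfield K) (g : GL (Fin 2) K)
    (h0 : ((0 : K) : OnePoint K) ∈ g • subline F) (h1 : ((1 : K) : OnePoint K) ∈ g • subline F)
    (hi : (∞ : OnePoint K) ∈ g • subline F) : g • subline F = subline F := by
  rw [Set.mem_smul_set_iff_inv_smul_mem, subline_eq_range_map] at h0 h1 hi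
  obtain ⟨x, hx⟩ := h0
  obtain ⟨y, hy⟩ := h1
  obtain ⟨z, hz⟩ := hi
  obtain ⟨k, k0, k1, ki⟩ := exists_smul_eq (x := x) (y := y) (z := z)
    (by rintro rfl; have := hx.symm.trans hy; simp at this)
    (by rintro rfl; have := hx.symm.trans hz; simp at this)
    (by rintro rfl; have := hy.symm.trans hz; simp at this)
  have key : ∀ w : OnePoint K, (g * k.map F.subtype) • w = w := by
    apply smul_eq_self_of_fixes
    · have : k.map F.subtype • ((0 : K) : OnePoint K) = OnePoint.map F.subtype x := by
        rw [← k0, OnePoint.map_smul]; simp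
      rw [mul_smul, this, hx, smul_inv_smul]
    · have : k.map F.subtype • ((1 : K) : OnePoint K) = OnePoint.map F.subtype y := by
        rw [← k1, OnePoint.map_smul]; simp
      rw [mul_smul, this, hy, smul_inv_smul]
    · have : k.map F.subtype • (∞ : OnePoint K) = OnePoint.map F.subtype z := by
        rw [← ki, OnePoint.map_smul]; simp
      rw [mul_smul, this, hz, smul_inv_smul]
  conv_lhs => rw [← map_smul_subline F k, smul_smul]
  ext w
  rw [Set.mem_smul_set]
  simp [key]

open OnePoint Pointwise in
theorem isSteinerSystem_sphericalSystem {q : ℕ} (hq : 2 ≤ q) {K : Type*} [Field K]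
    (F : Subfield K) (hF : Nat.card F = q) {n : ℕ} (e : OnePoint K ≃ Fin n) :
    IsSteinerSystem n (q + 1) 3 (sphericalSystem F e) := by
  classical
  constructor
  · rintro B ⟨L, ⟨g, rfl⟩, hB⟩
    have hfin : Finite F := Nat.finite_of_card_ne_zero (by omega)
    rw [← Set.ncard_coe_finset, hB, Set.ncard_image_of_injective _ e.injective]
    simp only
    rw [Set.ncard_smul_set, subline, Set.ncard_insert_of_notMem (by simp)
      ((Set.toFinite (F : Set K)).image _), Set.ncard_image_of_injective _ OnePoint.coe_injective]
    rw [← hF]; rfl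
  · intro X hX
    obtain ⟨a, b, c, hab, hac, hbc, rfl⟩ := Finset.card_eq_three.1 hX
    obtain ⟨g, g0, g1, gi⟩ := exists_smul_eq (e.symm.injective.ne hab) (e.symm.injective.ne hac)
      (e.symm.injective.ne hbc)
    have hsub : ∀ (B : Finset (Fin n)) (L : Set (OnePoint K)), (B : Set (Fin n)) = e '' L →
        ({a, b, c} ⊆ B ↔ e.symm a ∈ L ∧ e.symm b ∈ L ∧ e.symm c ∈ L) := by
      intro B L hB
      have : ∀ x, x ∈ B ↔ e.symm x ∈ L := by
        intro x; rw [← Finset.mem_coe, hB]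
        simp
      simp [Finset.insert_subset_iff, this]
    have hm0 : ((0 : K) : OnePoint K) ∈ subline F := Or.inr ⟨0, F.zero_mem, rfl⟩
    have hm1 : ((1 : K) : OnePoint K) ∈ subline F := Or.inr ⟨1, F.one_mem, rfl⟩
    have hmi : (∞ : OnePoint K) ∈ subline F := Or.inl rfl
    refine ⟨(e '' (g • subline F)).toFinset, ⟨⟨_, ⟨g, rfl⟩, by simp⟩, ?_⟩, ?_⟩
    · rw [hsub _ _ (Set.coe_toFinset _), ← g0, ← g1, ← gi]
      exact ⟨Set.smul_mem_smul_set hm0, Set.smul_mem_smul_set hm1, Set.smul_mem_smul_set hmi⟩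
    · rintro B ⟨⟨_, ⟨k, rfl⟩, hB⟩, hX⟩
      rw [hsub _ _ hB, ← g0, ← g1, ← gi] at hX
      simp only at hX hB
      have hk := smul_subline_eq_of_mem F (g⁻¹ * k)
        (by rw [mul_smul, Set.mem_inv_smul_set_iff]; exact hX.1)
        (by rw [mul_smul, Set.mem_inv_smul_set_iff]; exact hX.2.1)
        (by rw [mul_smul, Set.mem_inv_smul_set_iff]; exact hX.2.2)
      rw [mul_smul, inv_smul_eq_iff] at hk
      rw [← Finset.coe_inj, hB, hk, Set.coe_toFinset]

/-! ### Assignment of the diagonal blocks and distribution of the vectors -/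

/-- The non-central diagonal blocks correspond to the ordered pairs of distinct row blocks,
`(a, a, b)` to `(a, b)` and `(a, b, b)` to `(b, a)`. -/
theorem card_nonCentral_within {m : ℕ} (S : Finset (Fin m)) [DecidablePred (Within S)] :
    ((nonCentral m).filter (Within S)).card = S.offDiag.card := by
  refine Finset.card_nbij' (fun t => if t.1 = t.2.1 then (t.1, t.2.2) else (t.2.2, t.1))
    (fun x => if x.2 < x.1 then (x.1, x.1, x.2) else (x.2, x.1, x.1)) ?_ ?_ ?_ ?_
  · rintro ⟨i, j, k⟩ ht
    simp only [nonCentral, Within, Finset.coe_filter, Set.mem_ofPred_eq, Finset.mem_filter,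
      Finset.mem_univ, true_and] at ht
    obtain ⟨ht, hi, hj, hk⟩ := ht
    simp only [Finset.coe_offDiag, Set.mem_offDiag, Finset.mem_coe]
    rcases ht with ⟨rfl, h⟩ | ⟨h, rfl⟩
    · simp [hi, hk, h.ne']
    · simp [hi, hj, h.ne, h.ne']
  · rintro ⟨a, b⟩ hx
    simp only [Finset.coe_offDiag, Set.mem_offDiag, Finset.mem_coe] at hx
    simp only [nonCentral, Within, Finset.coe_filter, Set.mem_ofPred_eq, Finset.mem_filter,
      Finset.mem_univ, true_and]
    by_cases h : b < a
    · simp [h, hx]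
    · have : a < b := lt_of_le_of_ne (not_lt.1 h) hx.2.2
      simp [h, this, hx]
  · rintro ⟨i, j, k⟩ ht
    simp only [nonCentral, Finset.coe_filter, Set.mem_ofPred_eq, Finset.mem_filter,
      Finset.mem_univ, true_and] at ht
    rcases ht.1 with ⟨rfl, h⟩ | ⟨h, rfl⟩
    · simp [h]
    · simp [h.ne', h.le]
  · rintro ⟨a, b⟩ hx
    simp only [Finset.coe_offDiag, Set.mem_offDiag, Finset.mem_coe] at hx
    by_cases h : b < a
    · simp [h]
    · simp [h, Ne.symm hx.2.2]

namespace IsInversivePlane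

variable {m P q : ℕ} {R : Fin P → Finset (Fin m)} (H : IsInversivePlane q R)
include H

theorem card_rowProcs (i : Fin m) : (rowProcs R i).card = q * (q + 1) := H.card_point i

theorem card_eq_rows : m = q ^ 2 + 1 := by simpa using H.card_points

theorem card_eq_procs : P = q * (q ^ 2 + 1) := by simpa using H.card_index

theorem pos : 0 < q := lt_of_lt_of_le two_pos H.two_le

theorem existsUnique_mem_tetra {t : BlockIndex m} (ht : t ∈ offDiagonal m) :
    ∃! p, t ∈ tetra (R p) := by
  simp only [tetra, Finset.mem_filter, ht, true_and]
  simp only [offDiagonal, Finset.mem_filter, Finset.mem_univ, true_and] at ht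
  exact H.existsUnique_block _ _ _ ht.1.ne' (ht.2.trans ht.1).ne' ht.2.ne'

omit H in
theorem card_offDiag {V : Type*} [DecidableEq V] (S : Finset V) (hS : S.card = q + 1) :
    S.offDiag.card = q * (q + 1) := by
  rw [Finset.offDiag_card, hS, Nat.sub_eq_iff_eq_add (by nlinarith)]; ring

/-- Matching the non-central diagonal blocks with `q` slots per processor, where the slots of `p` are
compatible with the blocks within `R p`. Both sides of this relation have degree `q * (q + 1)`. -/
theorem exists_nonCentral_equiv :
    ∃ e : {t // t ∈ nonCentral m} ≃ Fin P × Fin q, ∀ t, Within (R (e t).1) t.1 := by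
  classical
  have hl : ∀ t : {t // t ∈ nonCentral m},
      (Finset.univ.filter fun x : Fin P × Fin q => Within (R x.1) t.1).card = q * (q + 1) := by
    rintro ⟨⟨i, j, k⟩, ht⟩
    have hpair : ∃ a b, a ≠ b ∧ ∀ p, Within (R p) (i, j, k) ↔ a ∈ R p ∧ b ∈ R p := by
      simp only [nonCentral, Finset.mem_filter, Finset.mem_univ, true_and] at ht
      rcases ht with ⟨rfl, h⟩ | ⟨h, rfl⟩
      · exact ⟨i, k, h.ne', fun p => by simp [Within]⟩
      · exact ⟨i, j, h.ne', fun p => by simp [Within]⟩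
    obtain ⟨a, b, hab, h⟩ := hpair
    have : (Finset.univ.filter fun x : Fin P × Fin q => Within (R x.1) (i, j, k))
        = (Finset.univ.filter fun p => a ∈ R p ∧ b ∈ R p) ×ˢ Finset.univ := by
      ext x; simp [h]
    rw [this, Finset.card_product, H.card_pair hab, Finset.card_univ, Fintype.card_fin, mul_comm]
  have hr : ∀ x : Fin P × Fin q, (Finset.univ.filter
      fun t : {t // t ∈ nonCentral m} => Within (R x.1) t.1).card ≤ q * (q + 1) := by
    rintro ⟨p, c⟩
    rw [← card_offDiag _ (H.card_block p), ← card_nonCentral_within,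
      ← Finset.card_map (Function.Embedding.subtype _)]
    refine Finset.card_le_card fun t ht => ?_
    simpa [and_comm] using ht
  have hcard : Fintype.card {t // t ∈ nonCentral m} = Fintype.card (Fin P × Fin q) := by
    have h := card_nonCentral_within (Finset.univ : Finset (Fin m))
    rw [Finset.filter_true_of_mem (fun t _ => by simp [Within]), Finset.offDiag_card,
      Finset.card_univ, Fintype.card_fin] at h
    rw [Fintype.card_coe, Fintype.card_prod, Fintype.card_fin, Fintype.card_fin, h,
      H.card_eq_procs, H.card_eq_rows, Nat.sub_eq_iff_eq_add (by nlinarith)]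
    ring
  obtain ⟨f, hf, hw⟩ := exists_injective_of_card_le
    (fun (t : {t // t ∈ nonCentral m}) (x : Fin P × Fin q) => Within (R x.1) t.1)
    (d := q * (q + 1)) (Nat.mul_pos H.pos (Nat.succ_pos q)) (fun t => (hl t).ge) hr
  exact ⟨Equiv.ofBijective f ((Fintype.bijective_iff_injective_and_card f).2 ⟨hf, hcard⟩), hw⟩

theorem exists_central_injective :
    ∃ g : Fin m → Fin P, Function.Injective g ∧ ∀ i, i ∈ R (g i) := by
  refine exists_injective_of_card_le (fun i p => i ∈ R p) (show 0 < q + 1 by omega) (fun i => ?_)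
    fun p => ?_
  · rw [H.card_point]
    exact Nat.le_mul_of_pos_left _ H.pos
  · rw [← H.card_block p]
    exact Finset.card_le_card fun i hi => by simpa using hi

theorem exists_isDiagonalAssignment : ∃ N D, IsDiagonalAssignment q R N D := by
  classical
  obtain ⟨e, he⟩ := H.exists_nonCentral_equiv
  obtain ⟨g, hg, hgR⟩ := H.exists_central_injective
  have hN : ∀ p t, t ∈ Finset.univ.image (fun c : Fin q => (e.symm (p, c)).1) ↔
      ∃ ht : t ∈ nonCentral m, (e ⟨t, ht⟩).1 = p := by
    intro p t
    simp only [Finset.mem_image, Finset.mem_univ, true_and]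
    constructor
    · rintro ⟨c, rfl⟩
      exact ⟨(e.symm (p, c)).2, by simp⟩
    · rintro ⟨ht, rfl⟩
      exact ⟨(e ⟨t, ht⟩).2, by simp⟩
  have hD : ∀ p t, t ∈ (Finset.univ.filter fun i => g i = p).image (fun i => (i, i, i)) ↔
      ∃ i, g i = p ∧ (i, i, i) = t := by
    intro p t; simp
  have hc : ∀ t, t ∈ central m ↔ ∃ i, (i, i, i) = t := by
    rintro ⟨i, j, k⟩
    simp only [central, Finset.mem_filter, Finset.mem_univ, true_and, Prod.mk.injEq]
    constructor
    · rintro ⟨rfl, rfl⟩; exact ⟨i, rfl, rfl, rfl⟩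
    · rintro ⟨_, rfl, rfl, rfl⟩; exact ⟨rfl, rfl⟩
  refine ⟨fun p => Finset.univ.image (fun c : Fin q => (e.symm (p, c)).1),
    fun p => (Finset.univ.filter fun i => g i = p).image (fun i => (i, i, i)),
    ⟨fun p t ht => ((hN p t).1 ht).1, fun p t ht => ?_, fun t ht => ?_, fun t ht => ?_,
      fun p => ?_, fun p => ?_, fun p t ht => ?_, fun p t ht => ?_⟩⟩
  · obtain ⟨i, -, hi⟩ := (hD p t).1 ht
    exact (hc t).2 ⟨i, hi⟩
  · simp only [hN]
    exact ⟨(e ⟨t, ht⟩).1, ⟨ht, rfl⟩, fun p hp => hp.2.symm⟩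
  · simp only [hD]
    obtain ⟨i, rfl⟩ := (hc t).1 ht
    refine ⟨g i, ⟨i, rfl, rfl⟩, ?_⟩
    rintro p ⟨j, rfl, hj⟩
    rw [Prod.mk.injEq] at hj
    rw [hj.1]
  · rw [Finset.card_image_of_injective, Finset.card_univ, Fintype.card_fin]
    intro c c' h
    have := e.symm.injective (Subtype.ext h)
    simpa using this
  · refine Finset.card_image_le.trans (Finset.card_le_one.2 fun i hi j hj => hg ?_)
    rw [(Finset.mem_filter.1 hi).2, (Finset.mem_filter.1 hj).2]
  · obtain ⟨ht', rfl⟩ := (hN p t).1 ht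
    exact he ⟨t, ht'⟩
  · obtain ⟨i, rfl, rfl⟩ := (hD p t).1 ht
    exact ⟨hgR i, hgR i, hgR i⟩

theorem exists_isEvenDistribution {b : ℕ} (hb : q * (q + 1) ∣ b) :
    ∃ owner : Fin m → Fin b → Fin P, IsEvenDistribution R owner := by
  classical
  obtain ⟨c, rfl⟩ := hb
  have E : ∀ i, Nonempty (Fin (q * (q + 1) * c) ≃ {p // p ∈ rowProcs R i} × Fin c) := fun i =>
    Fintype.card_eq.1 (by simp [H.card_rowProcs])
  replace E := fun i => (E i).some
  refine ⟨fun i s => ((E i) s).1, fun i s => ((E i) s).1.2, fun i p hp => ?_⟩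
  have : (Finset.univ.filter fun s => (((E i) s).1 : Fin P) = p)
      = Finset.univ.image fun k : Fin c => (E i).symm (⟨p, hp⟩, k) := by
    ext s
    simp only [Finset.mem_filter, Finset.mem_univ, true_and, Finset.mem_image]
    constructor
    · rintro rfl
      exact ⟨((E i) s).2, by simp⟩
    · rintro ⟨k, rfl⟩
      simp
  rw [this, Finset.card_image_of_injective, Finset.card_univ, Fintype.card_fin, H.card_rowProcs,
    mul_comm]
  intro k k' h
  simpa using h

variable {b : ℕ} {owner : Fin m → Fin b → Fin P} (ho : IsEvenDistribution R owner)
include ho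

omit H in
theorem mem_owner (i : Fin m) (s : Fin b) : i ∈ R (owner i s) := by
  simpa [rowProcs] using ho.1 i s

/-- The portion owned by `p` of the row blocks in `I`, all of which `p` requires. -/
theorem card_owned {p : Fin P} {I : Finset (Fin m)} (hI : I ⊆ R p) :
    (Finset.univ.filter fun w : Word m b => w.1 ∈ I ∧ owner w.1 w.2 = p).card * (q * (q + 1))
      = I.card * b := by
  have : (Finset.univ.filter fun w : Word m b => w.1 ∈ I ∧ owner w.1 w.2 = p)
      = (I.sigma fun i => Finset.univ.filter fun s => owner i s = p).map
        (Equiv.sigmaEquivProd _ _).toEmbedding := by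
    ext w
    simp only [Finset.mem_filter, Finset.mem_univ, true_and, Finset.mem_map_equiv,
      Finset.mem_sigma]
    rfl
  rw [this, Finset.card_map, Finset.card_sigma, Finset.sum_mul, ← smul_eq_mul I.card,
    ← Finset.sum_const]
  refine Finset.sum_congr rfl fun i hi => ?_
  rw [← H.card_rowProcs i]
  exact ho.2 i p (by simpa [rowProcs] using hI hi)

theorem card_gatherMsg (p r : Fin P) :
    (gatherMsg R owner p r).card * (q * (q + 1)) = (R p ∩ R r).card * b := by
  rw [← H.card_owned ho (p := p) Finset.inter_subset_left]
  simp only [gatherMsg, Finset.mem_inter, and_assoc]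

theorem card_reduceMsg (p r : Fin P) :
    (reduceMsg R owner p r).card * (q * (q + 1)) = (R p ∩ R r).card * b := by
  rw [← H.card_owned ho (p := r) Finset.inter_subset_right]
  simp only [reduceMsg, Finset.mem_inter, and_assoc]

theorem card_owned_mul (p : Fin P) :
    (Finset.univ.filter fun w : Word m b => owner w.1 w.2 = p).card * (q * (q ^ 2 + 1))
      = (q ^ 2 + 1) * b := by
  have h := H.card_owned ho (p := p) subset_rfl
  have hf : (Finset.univ.filter fun w : Word m b => w.1 ∈ R p ∧ owner w.1 w.2 = p)
      = Finset.univ.filter fun w : Word m b => owner w.1 w.2 = p := by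
    refine Finset.filter_congr fun w _ => ⟨And.right, fun hw => ⟨?_, hw⟩⟩
    rw [← hw]
    exact mem_owner ho _ _
  rw [hf, H.card_block] at h
  refine Nat.eq_of_mul_eq_mul_right (show 0 < q + 1 by omega) ?_
  calc _ = (q ^ 2 + 1) * ((Finset.univ.filter fun w : Word m b => owner w.1 w.2 = p).card
        * (q * (q + 1))) := by ring
    _ = _ := by rw [h]; ring

end IsInversivePlane

/-! ### The communication schedule -/

/-- The processors that exchange messages with `r`. -/
def partners {m P : ℕ} (R : Fin P → Finset (Fin m)) (r : Fin P) : Finset (Fin P) :=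
  Finset.univ.filter fun p => p ≠ r ∧ (R p ∩ R r).Nonempty

/-- In every step of `σ` each processor receives a message from one of its partners, which has the
same number of row blocks in common with it for all processors; and in the course of `σ` every
processor hears from each of its partners exactly once. -/
structure IsExchange {m P : ℕ} (R : Fin P → Finset (Fin m)) (σ : List (CommStep P)) : Prop where
  isSchedule : IsSchedule σ
  uniform : ∀ src ∈ σ, ∃ k, ∀ r, ∃ p, src r = some p ∧ (R p ∩ R r).card = k
  sources : ∀ r, ((σ.map fun src => src r : List (Option (Fin P))) : Multiset (Option (Fin P)))
    = (partners R r).val.map some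

theorem IsInversivePlane.exists_isExchange {m P q : ℕ} {R : Fin P → Finset (Fin m)}
    (H : IsInversivePlane q R) :
    ∃ σ : List (CommStep P), IsExchange R σ ∧ 2 * σ.length + 2 = q ^ 3 + 3 * q ^ 2 := by
  have hsymm : ∀ k b, (Finset.univ.filter fun a => a ≠ b ∧ (R a ∩ R b).card = k)
      = Finset.univ.filter fun a => b ≠ a ∧ (R b ∩ R a).card = k := fun k b =>
    Finset.filter_congr fun a _ => by rw [ne_comm, Finset.inter_comm]
  have hcard2 : ∀ a, (Finset.univ.filter fun b => a ≠ b ∧ (R a ∩ R b).card = 2).card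
      = q ^ 2 * (q + 1) / 2 := fun a => by
    rw [← H.two_mul_card_inter_eq_two a, Nat.mul_div_cancel_left _ two_pos]
  obtain ⟨l₂, hl₂, h₂⟩ := exists_perm_decomposition (q ^ 2 * (q + 1) / 2)
    (fun a b => a ≠ b ∧ (R a ∩ R b).card = 2) hcard2 (fun b => by rw [hsymm]; exact hcard2 b)
  obtain ⟨l₁, hl₁, h₁⟩ := exists_perm_decomposition (q ^ 2 - 1)
    (fun a b => a ≠ b ∧ (R a ∩ R b).card = 1) H.card_inter_eq_one
    (fun b => by rw [hsymm]; exact H.card_inter_eq_one b)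
  have hmem : ∀ π ∈ l₂ ++ l₁, ∃ k, ∀ a, a ≠ π a ∧ (R a ∩ R (π a)).card = k := by
    intro π hπ
    rcases List.mem_append.1 hπ with hπ | hπ
    · refine ⟨2, fun a => ?_⟩
      have : π a ∈ ((l₂.map fun π => π a : List (Fin P)) : Multiset (Fin P)) :=
        Multiset.mem_coe.2 (List.mem_map_of_mem hπ)
      rw [h₂] at this
      simpa using this
    · refine ⟨1, fun a => ?_⟩
      have : π a ∈ ((l₁.map fun π => π a : List (Fin P)) : Multiset (Fin P)) :=
        Multiset.mem_coe.2 (List.mem_map_of_mem hπ)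
      rw [h₁] at this
      simpa using this
  have hsteps : ∀ src ∈ (l₂ ++ l₁).map (fun π => fun r => some (π r) : _ → CommStep P),
      ∃ π ∈ l₂ ++ l₁, (fun r => some (π r)) = src := fun src h => List.mem_map.1 h
  refine ⟨(l₂ ++ l₁).map (fun π => fun r => some (π r)), ⟨?_, ?_, ?_⟩, ?_⟩
  · intro src hsrc
    obtain ⟨π, hπ, rfl⟩ := hsteps src hsrc
    obtain ⟨k, hk⟩ := hmem π hπ
    refine ⟨fun r r' p hr hr' => π.injective ?_, fun r h => (hk r).1 ?_⟩
    · exact Option.some.inj (hr.trans hr'.symm)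
    · exact (Option.some.inj h).symm
  · intro src hsrc
    obtain ⟨π, hπ, rfl⟩ := hsteps src hsrc
    obtain ⟨k, hk⟩ := hmem π hπ
    exact ⟨k, fun r => ⟨π r, rfl, by rw [Finset.inter_comm]; exact (hk r).2⟩⟩
  · intro r
    have hpart : (partners R r).val
        = ((l₂.map fun π => π r : List (Fin P)) : Multiset (Fin P))
          + ((l₁.map fun π => π r : List (Fin P)) : Multiset (Fin P)) := by
      rw [h₂, h₁, ← Finset.disjUnion_val _ _ (Finset.disjoint_filter.2 fun x _ hx hx' => by omega),
        Finset.disjUnion_eq_union, ← Finset.filter_or, partners]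
      congr 1
      refine Finset.filter_congr fun p _ => ?_
      rw [ne_comm, Finset.inter_comm, ← Finset.card_pos, ← and_or_left]
      refine and_congr_right fun hp => ?_
      have := H.card_inter_le_two hp
      omega
    rw [hpart, List.map_map, Multiset.coe_add, Multiset.map_coe, ← List.map_append, List.map_map]
    rfl
  · have hq : 1 ≤ q ^ 2 := Nat.one_le_pow _ _ H.pos
    have h3 : q ^ 2 * (q + 1) = q ^ 3 + q ^ 2 := by ring
    have h0 : 2 * (q ^ 2 * (q + 1) / 2) = q ^ 2 * (q + 1) := by
      obtain ⟨p⟩ : Nonempty (Fin P) := by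
        rw [← Fin.pos_iff_nonempty, H.card_eq_procs]
        exact Nat.mul_pos H.pos (Nat.succ_pos _)
      rw [← hcard2 p, H.two_mul_card_inter_eq_two]
    rw [List.length_map, List.length_append, hl₂, hl₁]
    omega

namespace IsExchange

variable {m P b q : ℕ} {R : Fin P → Finset (Fin m)} {σ : List (CommStep P)}
  (E : IsExchange R σ)
include E

theorem sum_map {M : Type*} [AddCommMonoid M] (r : Fin P) (f : Option (Fin P) → M) :
    (σ.map fun src => f (src r)).sum = ∑ p ∈ partners R r, f (some p) := by
  have h := congrArg (fun s => (s.map f).sum) (E.sources r)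
  rw [Multiset.map_coe, List.map_map, Multiset.sum_coe, Multiset.map_map] at h
  exact h

theorem exists_step_iff (r p : Fin P) : (∃ src ∈ σ, src r = some p) ↔ p ∈ partners R r := by
  have h : some p ∈ ((σ.map fun src => src r : List (Option (Fin P))) : Multiset (Option (Fin P)))
      ↔ p ∈ partners R r := by rw [E.sources r]; simp
  simpa using h

omit E in
theorem sum_partners (H : IsInversivePlane q R) (r : Fin P) :
    ∑ p ∈ partners R r, (R p ∩ R r).card = (q + 1) * (q ^ 2 + q - 1) := by
  rw [← H.sum_card_inter r]
  simp only [Finset.inter_comm (R r)]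
  refine Finset.sum_subset (fun p hp => by simp_all [partners]) fun p hp hp' => ?_
  simp only [partners, Finset.mem_filter, Finset.mem_univ, true_and, not_and,
    Finset.not_nonempty_iff_eq_empty] at hp'
  rw [hp' (Finset.ne_of_mem_erase hp), Finset.card_empty]

variable (H : IsInversivePlane q R) {msg : Fin P → Fin P → Finset (Word m b)}
  (hmsg : ∀ p r, (msg p r).card * (q * (q + 1)) = (R p ∩ R r).card * b)
include H hmsg

theorem wordsReceived_mul (r : Fin P) :
    wordsReceived msg σ r * (q * (q + 1)) = (q + 1) * (q ^ 2 + q - 1) * b := by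
  unfold wordsReceived receivedInStep
  rw [E.sum_map r fun o => o.elim 0 fun p => (msg p r).card, ← sum_partners H r, Finset.sum_mul,
    Finset.sum_mul]
  exact Finset.sum_congr rfl fun p _ => hmsg p r

theorem wordsSent_mul (p : Fin P) :
    wordsSent msg σ p * (q * (q + 1)) = (q + 1) * (q ^ 2 + q - 1) * b := by
  have hswap : wordsSent msg σ p
      = ∑ r, (σ.map fun src => if src r = some p then (msg p r).card else 0).sum := by
    clear E
    unfold wordsSent sentInStep
    induction σ with
    | nil => simp
    | cons src σ ih => simp [Finset.sum_add_distrib, ih]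
  have hpart : ∀ r, (σ.map fun src => if src r = some p then (msg p r).card else 0).sum
      = if r ∈ partners R p then (msg p r).card else 0 := by
    intro r
    rw [E.sum_map r fun o => if o = some p then (msg p r).card else 0]
    have : r ∈ partners R p ↔ p ∈ partners R r := by
      simp [partners, Finset.inter_comm, ne_comm]
    simp [this]
  rw [hswap, Finset.sum_congr rfl fun r _ => hpart r, Finset.sum_ite_mem, Finset.univ_inter,
    ← sum_partners H p, Finset.sum_mul, Finset.sum_mul]
  refine Finset.sum_congr rfl fun r _ => ?_
  rw [hmsg, Finset.inter_comm]

/-- As all messages of a step have the same length, the bandwidth cost is the number of words that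
any one processor receives. -/
theorem bandwidthCost_eq (r : Fin P) : bandwidthCost msg σ = wordsReceived msg σ r := by
  unfold bandwidthCost wordsReceived
  congr 1
  refine List.map_congr_left fun src hsrc => ?_
  obtain ⟨k, hk⟩ := E.uniform src hsrc
  have hconst : ∀ r', receivedInStep msg src r' = receivedInStep msg src r := by
    intro r'
    obtain ⟨p, hp, hpk⟩ := hk r
    obtain ⟨p', hp', hpk'⟩ := hk r'
    rw [receivedInStep, receivedInStep, hp, hp']
    refine Nat.eq_of_mul_eq_mul_right (Nat.mul_pos H.pos (Nat.succ_pos q)) ?_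
    exact (hmsg p' r').trans ((hpk'.trans hpk.symm ▸ rfl : _ = (R p ∩ R r).card * b).trans
      (hmsg p r).symm)
  refine le_antisymm (Finset.sup_le fun r' _ => (hconst r').le) ?_
  exact Finset.le_sup (f := fun r => receivedInStep msg src r) (Finset.mem_univ r)

omit E hmsg in
theorem cast_eq_costPerVector {w n : ℕ} (hn : n = m * b)
    (hw : w * (q * (q + 1)) = (q + 1) * (q ^ 2 + q - 1) * b) : (w : ℝ) = costPerVector q n := by
  have hq := H.pos
  have hq' : (0 : ℝ) < q := by exact_mod_cast hq
  have h1 : 1 ≤ q ^ 2 + q := by omega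
  have hw' : (w : ℝ) * (q * (q + 1)) = (q + 1) * (q ^ 2 + q - 1) * b := by
    have := congrArg (Nat.cast : ℕ → ℝ) hw
    push_cast [Nat.cast_sub h1] at this
    exact this
  have hw'' : (w : ℝ) * q = (q ^ 2 + q - 1) * b :=
    mul_right_cancel₀ (show (q : ℝ) + 1 ≠ 0 by positivity) (by linear_combination hw')
  have hm : (n : ℝ) = ((q : ℝ) ^ 2 + 1) * b := by
    rw [hn, H.card_eq_rows]; push_cast; ring
  rw [costPerVector, hm, eq_comm]
  field_simp
  linear_combination -hw''

end IsExchange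

/-! ### Correctness of the algorithm -/

section Gather

variable {m P b n : ℕ} (h : n = m * b) {R : Fin P → Finset (Fin m)}
  {owner : Fin m → Fin b → Fin P}

theorem gatherX_eq (ho : IsEvenDistribution R owner) (σ : List (CommStep P)) (x : Fin n → ℝ)
    (p : Fin P) (i : Fin m) (s : Fin b) :
    gatherX h R owner σ x p i s
      = if owner i s = p ∨ (i ∈ R p ∧ ∃ src ∈ σ, src p = some (owner i s))
        then some (x (entry h i s)) else none := by
  induction σ using List.reverseRecOn generalizing p with
  | nil => simp [gatherX, initialX]
  | append_singleton σ src ih =>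
    have hstep : gatherX h R owner (σ ++ [src]) x
        = gatherStep R owner (gatherX h R owner σ x) src := by
      simp [gatherX, List.foldl_append]
    rw [hstep, gatherStep]
    have hi := IsInversivePlane.mem_owner ho i s
    rcases hsrc : src p with _ | r
    · simp [ih, hsrc]
    · simp only [Option.elim_some, gatherMsg, Finset.mem_filter, Finset.mem_univ, true_and]
      by_cases hr : owner i s = r
      · subst hr
        by_cases hp : i ∈ R p
        · simp [ih, hi, hp, hsrc]
        · simp [ih, hp]
      · have hr' : r ≠ owner i s := Ne.symm hr
        simp [ih, hr, hr', hsrc]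

theorem IsExchange.gatherX_eq {σ : List (CommStep P)} (E : IsExchange R σ)
    (ho : IsEvenDistribution R owner) (x : Fin n → ℝ) (p : Fin P) (i : Fin m) (s : Fin b) :
    gatherX h R owner σ x p i s = if i ∈ R p then some (x (entry h i s)) else none := by
  rw [STTSV.gatherX_eq h ho]
  refine if_congr ?_ rfl rfl
  rw [E.exists_step_iff]
  have hi := IsInversivePlane.mem_owner ho i s
  constructor
  · rintro (rfl | hp)
    · exact hi
    · exact hp.1
  · intro hp
    by_cases ho : owner i s = p
    · exact Or.inl ho
    · refine Or.inr ⟨hp, ?_⟩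
      simp only [partners, Finset.mem_filter, Finset.mem_univ, true_and]
      exact ⟨ho, i, Finset.mem_inter.2 ⟨hi, hp⟩⟩

end Gather

section Reduce

variable {m P b : ℕ} {R : Fin P → Finset (Fin m)} {owner : Fin m → Fin b → Fin P}

theorem reduceY_eq (τ : List (CommStep P)) (Y : Fin P → Fin m → Fin b → ℝ) (r : Fin P)
    (i : Fin m) (s : Fin b) :
    reduceY R owner τ Y r i s = initialY owner Y r i s
      + (τ.map fun src => (src r).elim 0 fun p =>
          if (i, s) ∈ reduceMsg R owner p r then Y p i s else 0).sum := by
  induction τ using List.reverseRecOn with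
  | nil => simp [reduceY]
  | append_singleton τ src ih =>
    have hstep : reduceY R owner (τ ++ [src]) Y
        = reduceStep R owner Y (reduceY R owner τ Y) src := by
      simp [reduceY, List.foldl_append]
    rw [hstep, reduceStep, ih]
    simp [add_assoc]

theorem IsExchange.reduceY_owner {τ : List (CommStep P)} (E : IsExchange R τ)
    (ho : IsEvenDistribution R owner) {Y : Fin P → Fin m → Fin b → ℝ}
    (hY : ∀ p i, i ∉ R p → Y p i = 0) (i : Fin m) (s : Fin b) :
    reduceY R owner τ Y (owner i s) i s = ∑ p, Y p i s := by
  have hi := IsInversivePlane.mem_owner ho i s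
  rw [reduceY_eq, E.sum_map (owner i s) fun o => o.elim 0 fun p =>
    if (i, s) ∈ reduceMsg R owner p (owner i s) then Y p i s else 0]
  have hinit : initialY owner Y (owner i s) i s = Y (owner i s) i s := by simp [initialY]
  rw [hinit, ← Finset.add_sum_erase _ _ (Finset.mem_univ (owner i s))]
  congr 1
  have hsub : partners R (owner i s) ⊆ Finset.univ.erase (owner i s) := fun p hp => by
    simp_all [partners]
  have hterm : ∀ p, (if (i, s) ∈ reduceMsg R owner p (owner i s) then Y p i s else 0) = Y p i s := by
    intro p
    by_cases hp : i ∈ R p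
    · simp [reduceMsg, hp, hi]
    · simp [reduceMsg, hp, hY p i hp]
  simp only [Option.elim_some, hterm]
  refine Finset.sum_subset hsub fun p hp hp' => ?_
  rw [hY p i, Pi.zero_apply]
  intro hip
  refine hp' ?_
  simp only [partners, Finset.mem_filter, Finset.mem_univ, true_and]
  exact ⟨Finset.ne_of_mem_erase hp, i, Finset.mem_inter.2 ⟨hip, hi⟩⟩

end Reduce

section Compute

variable {m b : ℕ}

theorem blockUpdate_congr (B : Fin b → Fin b → Fin b → ℝ) {t : BlockIndex m}
    {x x' : Fin m → Fin b → ℝ} (h₁ : x t.1 = x' t.1) (h₂ : x t.2.1 = x' t.2.1)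
    (h₃ : x t.2.2 = x' t.2.2) : blockUpdate B t x = blockUpdate B t x' := by
  simp only [blockUpdate, h₁, h₂, h₃]

theorem blockUpdate_eq_zero (B : Fin b → Fin b → Fin b → ℝ) {t : BlockIndex m}
    (x : Fin m → Fin b → ℝ) {S : Finset (Fin m)} (ht : Within S t) {i : Fin m} (hi : i ∉ S) :
    blockUpdate B t x i = 0 := by
  obtain ⟨h₁, h₂, h₃⟩ := ht
  have n₁ : i ≠ t.1 := fun h => hi (h ▸ h₁)
  have n₂ : i ≠ t.2.1 := fun h => hi (h ▸ h₂)
  have n₃ : i ≠ t.2.2 := fun h => hi (h ▸ h₃)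
  simp only [blockUpdate]
  split_ifs <;> simp [Pi.single_eq_of_ne n₁, Pi.single_eq_of_ne n₂, Pi.single_eq_of_ne n₃]

/-- A sum over all triples, grouped by the decreasing rearrangement of the triple. -/
theorem sum_eq_sum_lower {M : Type*} [AddCommMonoid M] (g : Fin m → Fin m → Fin m → M) :
    ∑ i, ∑ j, ∑ k, g i j k
      = ∑ t ∈ offDiagonal m, (g t.1 t.2.1 t.2.2 + g t.1 t.2.2 t.2.1 + g t.2.1 t.1 t.2.2
          + g t.2.1 t.2.2 t.1 + g t.2.2 t.1 t.2.1 + g t.2.2 t.2.1 t.1)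
        + ∑ t ∈ nonCentral m, (g t.1 t.2.1 t.2.2
          + (if t.1 = t.2.1 then g t.1 t.2.2 t.2.1 else g t.2.1 t.1 t.2.2)
          + g t.2.2 t.2.1 t.1)
        + ∑ t ∈ central m, g t.1 t.2.1 t.2.2 := by
  have s₁ : ∀ f : Fin m → Fin m → Fin m → M,
      ∑ i, ∑ j, ∑ k, f i j k = ∑ i, ∑ j, ∑ k, f j i k := fun f => Finset.sum_comm
  have s₂ : ∀ f : Fin m → Fin m → Fin m → M,
      ∑ i, ∑ j, ∑ k, f i j k = ∑ i, ∑ j, ∑ k, f i k j := fun f =>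
    Finset.sum_congr rfl fun i _ => Finset.sum_comm
  have s₃ : ∀ f : Fin m → Fin m → Fin m → M,
      ∑ i, ∑ j, ∑ k, f i j k = ∑ i, ∑ j, ∑ k, f j k i := fun f => by rw [s₂ f, s₁]
  have s₄ : ∀ f : Fin m → Fin m → Fin m → M,
      ∑ i, ∑ j, ∑ k, f i j k = ∑ i, ∑ j, ∑ k, f k i j := fun f => by rw [s₁ f, s₂]
  have s₅ : ∀ f : Fin m → Fin m → Fin m → M,
      ∑ i, ∑ j, ∑ k, f i j k = ∑ i, ∑ j, ∑ k, f k j i := fun f => by rw [s₁ f, s₃]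
  have hoff : ∀ f : Fin m → Fin m → Fin m → M, ∑ t ∈ offDiagonal m, f t.1 t.2.1 t.2.2
      = ∑ i, ∑ j, ∑ k, if j < i ∧ k < j then f i j k else 0 := fun f => by
    simp only [offDiagonal, Finset.sum_filter, Fintype.sum_prod_type]
  have hcen : ∀ f : Fin m → Fin m → Fin m → M, ∑ t ∈ central m, f t.1 t.2.1 t.2.2
      = ∑ i, ∑ j, ∑ k, if i = j ∧ j = k then f i j k else 0 := fun f => by
    simp only [central, Finset.sum_filter, Fintype.sum_prod_type]
  have hnon : ∀ f : Fin m → Fin m → Fin m → M, ∑ t ∈ nonCentral m, f t.1 t.2.1 t.2.2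
      = ∑ i, ∑ j, ∑ k, if (i = j ∧ k < j) ∨ (j < i ∧ j = k) then f i j k else 0 := fun f => by
    simp only [nonCentral, Finset.sum_filter, Fintype.sum_prod_type]
  have hmid : ∑ t ∈ nonCentral m, (if t.1 = t.2.1 then g t.1 t.2.2 t.2.1 else g t.2.1 t.1 t.2.2)
      = (∑ i, ∑ j, ∑ k, if i = j ∧ k < j then g i k j else 0)
        + ∑ i, ∑ j, ∑ k, if j < i ∧ j = k then g j i k else 0 := by
    rw [hnon fun i j k => if i = j then g i k j else g j i k]
    simp only [← Finset.sum_add_distrib]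
    refine Finset.sum_congr rfl fun i _ => Finset.sum_congr rfl fun j _ =>
      Finset.sum_congr rfl fun k _ => ?_
    rcases lt_trichotomy i j with h | rfl | h
    · simp [h.ne, h.not_gt]
    · simp
    · simp [h.ne', h]
  simp only [Finset.sum_add_distrib]
  rw [hmid, hoff g, hoff fun i j k => g i k j, hoff fun i j k => g j i k,
    hoff fun i j k => g j k i, hoff fun i j k => g k i j, hoff fun i j k => g k j i,
    hnon g, hnon fun i j k => g k j i, hcen g,
    s₂ fun i j k => if j < i ∧ k < j then g i k j else 0,
    s₁ fun i j k => if j < i ∧ k < j then g j i k else 0,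
    s₄ fun i j k => if j < i ∧ k < j then g j k i else 0,
    s₃ fun i j k => if j < i ∧ k < j then g k i j else 0,
    s₅ fun i j k => if j < i ∧ k < j then g k j i else 0,
    s₂ fun i j k => if i = j ∧ k < j then g i k j else 0,
    s₁ fun i j k => if j < i ∧ j = k then g j i k else 0,
    s₅ fun i j k => if (i = j ∧ k < j) ∨ (j < i ∧ j = k) then g k j i else 0]
  simp only [← Finset.sum_add_distrib]
  refine Finset.sum_congr rfl fun i _ => Finset.sum_congr rfl fun j _ =>
    Finset.sum_congr rfl fun k _ => ?_
  clear s₁ s₂ s₃ s₄ s₅ hoff hcen hnon hmid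
  have tri : ∀ a c : Fin m, (a < c ∧ ¬ c < a ∧ a ≠ c ∧ c ≠ a) ∨ (a = c ∧ ¬ a < c ∧ ¬ c < a)
      ∨ (c < a ∧ ¬ a < c ∧ a ≠ c ∧ c ≠ a) := fun a c => by omega
  obtain ⟨h₁, h₂, h₃⟩ := And.intro (tri i j) (And.intro (tri i k) (tri j k))
  clear tri
  rcases h₁ with h₁ | h₁ | h₁ <;> rcases h₂ with h₂ | h₂ | h₂ <;> rcases h₃ with h₃ | h₃ | h₃ <;>
    first
      | (exfalso; omega)
      | simp [h₁, h₂, h₃]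

variable {n : ℕ} (h : n = m * b) {A : Fin n → Fin n → Fin n → ℝ}

/-- The blocks of the lower tetrahedron together contribute the row blocks of `y = A ×₂ x ×₃ x`: by
symmetry the contributions of a block are those of its up to six permuted copies. -/
theorem sum_blockUpdate (hA : IsSymmetricTensor A) (x : Fin n → ℝ) (a : Fin m) (s : Fin b) :
    (∑ t ∈ offDiagonal m, blockUpdate (tensorBlock h A t) t fun i s => x (entry h i s)) a s
      + (∑ t ∈ nonCentral m, blockUpdate (tensorBlock h A t) t fun i s => x (entry h i s)) a s
      + (∑ t ∈ central m, blockUpdate (tensorBlock h A t) t fun i s => x (entry h i s)) a s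
      = sttsv A x (entry h a s) := by
  set X : Fin m → Fin b → ℝ := fun i s => x (entry h i s) with hX
  let f : Fin m → Fin m → Fin m → Fin b → ℝ := fun i j k =>
    mul23 (tensorBlock h A (i, j, k)) (X j) (X k)
  let g : Fin m → Fin m → Fin m → Fin m → Fin b → ℝ := fun i j k => Pi.single i (f i j k)
  have hf : ∀ i j k, f i j k = f i k j := by
    intro i j k
    funext s
    simp only [f, mul23, tensorBlock]
    rw [Finset.sum_comm]
    refine Finset.sum_congr rfl fun u _ => Finset.sum_congr rfl fun v _ => ?_
    rw [(hA _ _ _).2]; ring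
  have h13 : ∀ i j k, mul13 (tensorBlock h A (i, j, k)) (X i) (X k) = f j i k := by
    intro i j k
    funext s
    simp only [f, mul23, mul13, tensorBlock]
    refine Finset.sum_congr rfl fun u _ => Finset.sum_congr rfl fun v _ => ?_
    rw [(hA _ _ _).1]
  have h12 : ∀ i j k, mul12 (tensorBlock h A (i, j, k)) (X i) (X j) = f k i j := by
    intro i j k
    funext s
    simp only [f, mul23, mul12, tensorBlock]
    refine Finset.sum_congr rfl fun u _ => Finset.sum_congr rfl fun v _ => ?_
    rw [(hA _ _ _).2, (hA _ _ _).1]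
  have h23 : ∀ i j k, mul23 (tensorBlock h A (i, j, k)) (X j) (X k) = f i j k := fun _ _ _ => rfl
  have hoff : ∀ t ∈ offDiagonal m, blockUpdate (tensorBlock h A t) t X
      = g t.1 t.2.1 t.2.2 + g t.1 t.2.2 t.2.1 + g t.2.1 t.1 t.2.2
          + g t.2.1 t.2.2 t.1 + g t.2.2 t.1 t.2.1 + g t.2.2 t.2.1 t.1 := by
    rintro ⟨i, j, k⟩ ht
    simp only [offDiagonal, Finset.mem_filter, Finset.mem_univ, true_and] at ht
    simp only [blockUpdate, ne_eq, ht.1.ne', ht.2.ne', not_false_eq_true, and_self, if_true,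
      h13, h12, h23, g, hf i k j, hf j k i, hf k j i, two_smul, Pi.single_add]
    abel
  have hnon : ∀ t ∈ nonCentral m, blockUpdate (tensorBlock h A t) t X
      = g t.1 t.2.1 t.2.2
          + (if t.1 = t.2.1 then g t.1 t.2.2 t.2.1 else g t.2.1 t.1 t.2.2)
          + g t.2.2 t.2.1 t.1 := by
    rintro ⟨i, j, k⟩ ht
    simp only [nonCentral, Finset.mem_filter, Finset.mem_univ, true_and] at ht
    rcases ht with ⟨rfl, hk⟩ | ⟨hi, rfl⟩
    · simp only [blockUpdate, ne_eq, hk.ne', not_false_eq_true, not_true_eq_false, false_and,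
        and_self, if_true, if_false, h12, h23, g, hf i k i, two_smul, Pi.single_add]
    · simp only [blockUpdate, ne_eq, hi.ne', not_false_eq_true, not_true_eq_false, and_false,
        and_self, if_true, if_false, h12, h23, g, hf j j i, two_smul, Pi.single_add]
      abel
  have hcen : ∀ t ∈ central m, blockUpdate (tensorBlock h A t) t X = g t.1 t.2.1 t.2.2 := by
    rintro ⟨i, j, k⟩ ht
    simp only [central, Finset.mem_filter, Finset.mem_univ, true_and] at ht
    obtain ⟨rfl, rfl⟩ := ht
    simp [blockUpdate, h23, g]
  rw [Finset.sum_congr rfl hoff, Finset.sum_congr rfl hnon, Finset.sum_congr rfl hcen,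
    ← Pi.add_apply, ← Pi.add_apply, ← Pi.add_apply, ← Pi.add_apply, ← sum_eq_sum_lower g]
  have hsingle : ∑ i, ∑ j, ∑ k, g i j k = fun a => ∑ j, ∑ k, f a j k := by
    funext a
    simp only [g, Finset.sum_apply]
    rw [Finset.sum_eq_single a (fun i _ hi => ?_) (by simp)]
    · simp
    · simp [Pi.single_eq_of_ne hi.symm]
  have hentry : ∀ F : Fin n → ℝ, ∑ j, F j = ∑ i : Fin m, ∑ s : Fin b, F (entry h i s) := by
    intro F
    rw [← Fintype.sum_prod_type' (f := fun i s => F (entry h i s))]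
    exact (Fintype.sum_equiv (finProdFinEquiv.trans (finCongr h.symm)) _ _ fun _ => rfl).symm
  rw [hsingle]
  simp only [Finset.sum_apply, sttsv, f, mul23, tensorBlock, hX, hentry]
  refine Finset.sum_congr rfl fun j _ => ?_
  rw [Finset.sum_comm]

variable {P q : ℕ} {R : Fin P → Finset (Fin m)} {N D : Fin P → Finset (BlockIndex m)}

theorem sum_sum_of_existsUnique {ι τ M : Type*} [Fintype ι] [AddCommMonoid M] [DecidableEq τ]
    {T : ι → Finset τ} {L : Finset τ} (hsub : ∀ p, T p ⊆ L) (hu : ∀ t ∈ L, ∃! p, t ∈ T p)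
    (f : τ → M) : ∑ p, ∑ t ∈ T p, f t = ∑ t ∈ L, f t := by
  classical
  have hL : L = Finset.univ.biUnion T := by
    ext t
    simp only [Finset.mem_biUnion, Finset.mem_univ, true_and]
    exact ⟨fun ht => (hu t ht).exists, fun ⟨p, hp⟩ => hsub p hp⟩
  rw [hL, Finset.sum_biUnion]
  intro p _ r _ hpr
  refine Finset.disjoint_left.2 fun t hp hr => hpr ?_
  exact (hu t (hsub p hp)).unique hp hr

theorem IsInversivePlane.sum_assigned (H : IsInversivePlane q R)
    (hND : IsDiagonalAssignment q R N D) {M : Type*} [AddCommMonoid M] (f : BlockIndex m → M) :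
    ∑ p, ∑ t ∈ tetra (R p) ∪ N p ∪ D p, f t
      = ∑ t ∈ offDiagonal m, f t + ∑ t ∈ nonCentral m, f t + ∑ t ∈ central m, f t := by
  have hT : ∀ p, tetra (R p) ⊆ offDiagonal m := fun p => Finset.filter_subset _ _
  have d₁ : Disjoint (offDiagonal m) (nonCentral m) := Finset.disjoint_filter.2 fun t _ ht ht' => by
    omega
  have d₂ : Disjoint (offDiagonal m) (central m) := Finset.disjoint_filter.2 fun t _ ht ht' => by
    omega
  have d₃ : Disjoint (nonCentral m) (central m) := Finset.disjoint_filter.2 fun t _ ht ht' => by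
    omega
  rw [← sum_sum_of_existsUnique hT (fun t ht => H.existsUnique_mem_tetra ht),
    ← sum_sum_of_existsUnique hND.nonCentral_subset hND.nonCentral_unique,
    ← sum_sum_of_existsUnique hND.central_subset hND.central_unique, ← Finset.sum_add_distrib,
    ← Finset.sum_add_distrib]
  refine Finset.sum_congr rfl fun p _ => ?_
  rw [Finset.sum_union, Finset.sum_union]
  · exact d₁.mono (hT p) (hND.nonCentral_subset p)
  · exact Finset.disjoint_union_left.2 ⟨d₂.mono (hT p) (hND.central_subset p),
      d₃.mono (hND.nonCentral_subset p) (hND.central_subset p)⟩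

theorem IsDiagonalAssignment.within (hND : IsDiagonalAssignment q R N D) {p : Fin P}
    {t : BlockIndex m} (ht : t ∈ tetra (R p) ∪ N p ∪ D p) : Within (R p) t := by
  rcases Finset.mem_union.1 ht with ht | ht
  · rcases Finset.mem_union.1 ht with ht | ht
    · exact (Finset.mem_filter.1 ht).2
    · exact hND.nonCentral_within p t ht
  · exact hND.central_within p t ht

theorem IsInversivePlane.parallelSTTSV_owner (H : IsInversivePlane q R)
    (hND : IsDiagonalAssignment q R N D) {owner : Fin m → Fin b → Fin P}
    (ho : IsEvenDistribution R owner) {σ τ : List (CommStep P)} (hσ : IsExchange R σ)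
    (hτ : IsExchange R τ) (hA : IsSymmetricTensor A) (x : Fin n → ℝ) (i : Fin m) (s : Fin b) :
    parallelSTTSV h R owner N D σ τ A x (owner i s) i s = sttsv A x (entry h i s) := by
  set Y := localY h (fun p => tetra (R p) ∪ N p ∪ D p) A (gatherX h R owner σ x) with hYdef
  -- every processor has gathered what its blocks of the tensor are multiplied with
  have hY : ∀ p, Y p = ∑ t ∈ tetra (R p) ∪ N p ∪ D p,
      blockUpdate (tensorBlock h A t) t fun i s => x (entry h i s) := by
    intro p
    refine Finset.sum_congr rfl fun t ht => ?_
    obtain ⟨h₁, h₂, h₃⟩ := hND.within ht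
    apply blockUpdate_congr <;> funext s <;> simp [hσ.gatherX_eq h ho, h₁, h₂, h₃]
  rw [parallelSTTSV, hτ.reduceY_owner ho fun p i hi => ?_]
  · rw [← sum_blockUpdate h hA, ← Pi.add_apply, ← Pi.add_apply, ← Pi.add_apply, ← Pi.add_apply,
      ← H.sum_assigned hND, ← Finset.sum_apply, ← Finset.sum_apply]
    simp only [← hYdef, hY]
  · rw [← hYdef, hY, Finset.sum_apply]
    exact Finset.sum_eq_zero fun t ht => blockUpdate_eq_zero _ _ (hND.within ht) hi

end Compute

/-! ### Comparison with the lower bound -/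

/-- The cube root of a nonnegative real number, with its defining equation. -/
theorem exists_rpow_one_third {y : ℝ} (hy : 0 ≤ y) :
    ∃ u : ℝ, y ^ (1 / 3 : ℝ) = u ∧ 0 ≤ u ∧ u ^ 3 = y := by
  refine ⟨_, rfl, Real.rpow_nonneg hy _, ?_⟩
  rw [← Real.rpow_natCast, ← Real.rpow_mul hy]
  norm_num

variable {ε : ℝ} {q n : ℕ}

theorem abs_costPerVector_sub_le (hε : 0 < ε) (hq : 2 ≤ q) (hqε : 4 / ε ≤ q) :
    |2 * costPerVector q n - leadingTerm n (q * (q ^ 2 + 1))|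
      ≤ ε * leadingTerm n (q * (q ^ 2 + 1)) := by
  have hq2 : (2 : ℝ) ≤ q := by exact_mod_cast hq
  have hP : ((q * (q ^ 2 + 1) : ℕ) : ℝ) = q * ((q : ℝ) ^ 2 + 1) := by push_cast; ring
  obtain ⟨u, hu, hu0, hu3⟩ := exists_rpow_one_third (y := q * ((q : ℝ) ^ 2 + 1)) (by positivity)
  have hqu : (q : ℝ) ≤ u :=
    (pow_le_pow_iff_left₀ (by positivity) hu0 three_ne_zero).1 (by rw [hu3]; nlinarith)
  have huq : u ≤ q + 1 :=
    (pow_le_pow_iff_left₀ hu0 (by positivity) three_ne_zero).1 (by rw [hu3]; nlinarith)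
  have hupos : 0 < u := by linarith
  have hcost : 2 * costPerVector q n = 2 * n / u ^ 3 * ((q : ℝ) ^ 2 + q - 1) := by
    rw [hu3, costPerVector]
    field_simp
  rw [leadingTerm, hP, hu, hcost]
  have hsplit : 2 * (n : ℝ) / u ^ 3 * ((q : ℝ) ^ 2 + q - 1) - 2 * n / u
      = 2 * n / u ^ 3 * ((q : ℝ) ^ 2 + q - 1 - u ^ 2) := by
    field_simp
  have hsplit' : ε * (2 * (n : ℝ) / u) = 2 * n / u ^ 3 * (ε * u ^ 2) := by
    field_simp
  rw [hsplit, hsplit', abs_mul, abs_of_nonneg (show 0 ≤ 2 * (n : ℝ) / u ^ 3 by positivity)]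
  refine mul_le_mul_of_nonneg_left ?_ (by positivity)
  have hεq : 4 ≤ ε * q := by rwa [div_le_iff₀ hε, mul_comm] at hqε
  have h1 : 4 * (q : ℝ) ≤ ε * u ^ 2 := by
    calc 4 * (q : ℝ) ≤ ε * q * q := by gcongr
      _ = ε * (q : ℝ) ^ 2 := by ring
      _ ≤ ε * u ^ 2 := by gcongr
  have h2 : (q : ℝ) ^ 2 ≤ u ^ 2 := by gcongr
  have h3 : u ^ 2 ≤ (q + 1 : ℝ) ^ 2 := by gcongr
  rw [abs_le]
  constructor <;> nlinarith

theorem abs_lowerBound_sub_le (hε : 0 < ε) (hq : 2 ≤ q) (hqε : 4 / ε ≤ q) (hn : q ≤ n) :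
    |lowerBound n (q * (q ^ 2 + 1)) - leadingTerm n (q * (q ^ 2 + 1))|
      ≤ ε * leadingTerm n (q * (q ^ 2 + 1)) := by
  have hq2 : (2 : ℝ) ≤ q := by exact_mod_cast hq
  have hqn : (q : ℝ) ≤ n := by exact_mod_cast hn
  have hP : ((q * (q ^ 2 + 1) : ℕ) : ℝ) = q * ((q : ℝ) ^ 2 + 1) := by push_cast; ring
  obtain ⟨u, hu, hu0, hu3⟩ := exists_rpow_one_third (y := q * ((q : ℝ) ^ 2 + 1)) (by positivity)
  have hqu : (q : ℝ) ≤ u :=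
    (pow_le_pow_iff_left₀ (by positivity) hu0 three_ne_zero).1 (by rw [hu3]; nlinarith)
  have hupos : 0 < u := by linarith
  have hn2 : 0 ≤ (n : ℝ) - 2 := by linarith
  have hn1 : 0 ≤ (n : ℝ) - 1 := by linarith
  obtain ⟨v, hv, hv0, hv3⟩ := exists_rpow_one_third
    (y := (n : ℝ) * (n - 1) * (n - 2) / (q * ((q : ℝ) ^ 2 + 1))) (by positivity)
  have hw3 : (v * u) ^ 3 = n * (n - 1) * (n - 2) := by
    rw [mul_pow, hv3, hu3, div_mul_cancel₀ _ (by positivity)]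
  have hwn : v * u ≤ n :=
    (pow_le_pow_iff_left₀ (by positivity) (by positivity) three_ne_zero).1
      (by rw [hw3]; nlinarith)
  have hnw : (n : ℝ) - 2 ≤ v * u :=
    (pow_le_pow_iff_left₀ hn2 (by positivity) three_ne_zero).1 (by rw [hw3]; nlinarith)
  have hεq : 4 ≤ ε * q := by rwa [div_le_iff₀ hε, mul_comm] at hqε
  have hεn : 4 ≤ ε * n := hεq.trans (by gcongr)
  have hεu : 4 ≤ ε * u ^ 2 := hεq.trans (by gcongr; nlinarith)
  rw [lowerBound, leadingTerm, hP, hv, hu, ← hu3]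
  have hsplit : 2 * v - 2 * ((n : ℝ) / u ^ 3) - 2 * n / u
      = -(2 / u ^ 3 * ((n - v * u) * u ^ 2 + n)) := by
    field_simp
    ring
  have hsplit' : ε * (2 * (n : ℝ) / u) = 2 / u ^ 3 * (ε * n * u ^ 2) := by
    field_simp
  have hdiff : 0 ≤ (n : ℝ) - v * u := by linarith
  rw [hsplit, hsplit', abs_neg, abs_of_nonneg (by positivity)]
  refine mul_le_mul_of_nonneg_left ?_ (by positivity)
  -- each of the two terms is at most half of `ε * n * u ^ 2`
  have h1 : ((n : ℝ) - v * u) * u ^ 2 ≤ ε * n / 2 * u ^ 2 := by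
    gcongr
    linarith
  have h2 : (n : ℝ) ≤ n * (ε * u ^ 2 / 2) := le_mul_of_one_le_right (by positivity) (by linarith)
  linarith

end STTSV

theorem mainTheorem3 :
    (∀ q : ℕ, IsPrimePow q →
      -- the spherical geometries are Steiner systems, with `P = q (q² + 1)` blocks
      (∀ (K : Type*) [Field K] (F : Subfield K), Nat.card K = q ^ 2 → Nat.card F = q →
        ∀ e : OnePoint K ≃ Fin (q ^ 2 + 1),
          STTSV.IsSteinerSystem (q ^ 2 + 1) (q + 1) 3 (STTSV.sphericalSystem F e)) ∧
      (∀ S, STTSV.IsSteinerSystem (q ^ 2 + 1) (q + 1) 3 S → S.ncard = q * (q ^ 2 + 1)) ∧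
      -- the blocks `R p` of any such system, numbered by the processors
      ∀ R : Fin (q * (q ^ 2 + 1)) → Finset (Fin (q ^ 2 + 1)), Function.Injective R →
        STTSV.IsSteinerSystem (q ^ 2 + 1) (q + 1) 3 (Set.range R) →
        -- the tetrahedral blocks partition the off-diagonal blocks
        (∀ t ∈ STTSV.offDiagonal (q ^ 2 + 1), ∃! p, t ∈ STTSV.tetra (R p)) ∧
        -- the diagonal blocks can be assigned
        (∃ N D, STTSV.IsDiagonalAssignment q R N D) ∧
        ∀ (n b : ℕ) (h : n = (q ^ 2 + 1) * b), q * (q + 1) ∣ b →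
          -- the vectors can be distributed
          (∃ owner : Fin (q ^ 2 + 1) → Fin b → Fin (q * (q ^ 2 + 1)),
            STTSV.IsEvenDistribution R owner) ∧
          ∀ owner : Fin (q ^ 2 + 1) → Fin b → Fin (q * (q ^ 2 + 1)),
            STTSV.IsEvenDistribution R owner →
            -- every processor owns `n / P` entries of each vector
            (∀ p, (Finset.univ.filter fun w : STTSV.Word (q ^ 2 + 1) b =>
              owner w.1 w.2 = p).card * (q * (q ^ 2 + 1)) = n) ∧
            ∀ N D, STTSV.IsDiagonalAssignment q R N D →
              -- point-to-point schedules for gathering `x` and for reducing `y`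
              ∃ σ τ : List (STTSV.CommStep (q * (q ^ 2 + 1))),
                STTSV.IsSchedule σ ∧ STTSV.IsSchedule τ ∧
                -- the number of steps
                (σ.length : ℝ) = (q : ℝ) ^ 3 / 2 + 3 * (q : ℝ) ^ 2 / 2 - 1 ∧
                (τ.length : ℝ) = (q : ℝ) ^ 3 / 2 + 3 * (q : ℝ) ^ 2 / 2 - 1 ∧
                -- the number of words, in each phase and in total
                (∀ p,
                  (STTSV.wordsSent (STTSV.gatherMsg R owner) σ p : ℝ)
                    = STTSV.costPerVector q n ∧
                  (STTSV.wordsReceived (STTSV.gatherMsg R owner) σ p : ℝ)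
                    = STTSV.costPerVector q n ∧
                  (STTSV.wordsSent (STTSV.reduceMsg R owner) τ p : ℝ)
                    = STTSV.costPerVector q n ∧
                  (STTSV.wordsReceived (STTSV.reduceMsg R owner) τ p : ℝ)
                    = STTSV.costPerVector q n) ∧
                (STTSV.bandwidthCost (STTSV.gatherMsg R owner) σ : ℝ)
                    + (STTSV.bandwidthCost (STTSV.reduceMsg R owner) τ : ℝ)
                  = 2 * STTSV.costPerVector q n ∧
                -- the algorithm is correct with these schedules
                ∀ (A : Fin n → Fin n → Fin n → ℝ) (x : Fin n → ℝ),
                  STTSV.IsSymmetricTensor A →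
                  (∀ p i s, STTSV.gatherX h R owner σ x p i s
                    = if i ∈ R p then some (x (STTSV.entry h i s)) else none) ∧
                  ∀ i s, STTSV.parallelSTTSV h R owner N D σ τ A x (owner i s) i s
                    = STTSV.sttsv A x (STTSV.entry h i s)) ∧
    -- the cost and the lower bound have the same leading term
    (∀ ε : ℝ, 0 < ε → ∃ q₀ : ℕ, ∀ q : ℕ, q₀ ≤ q → IsPrimePow q →
      ∀ n : ℕ, 0 < n → q * (q + 1) * (q ^ 2 + 1) ∣ n →
        |2 * STTSV.costPerVector q n - STTSV.leadingTerm n (q * (q ^ 2 + 1))|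
          ≤ ε * STTSV.leadingTerm n (q * (q ^ 2 + 1)) ∧
        |STTSV.lowerBound n (q * (q ^ 2 + 1)) - STTSV.leadingTerm n (q * (q ^ 2 + 1))|
          ≤ ε * STTSV.leadingTerm n (q * (q ^ 2 + 1))) := by
  refine ⟨fun q hpp => ?_, fun ε hε => ?_⟩
  · have hq : 2 ≤ q := hpp.two_le
    refine ⟨fun K _ F _ hF e => STTSV.isSteinerSystem_sphericalSystem hq F hF e,
      fun S hS => hS.ncard_eq hq, fun R hR hS => ?_⟩
    have H := hS.isInversivePlane hq hR
    refine ⟨fun t ht => H.existsUnique_mem_tetra ht, H.exists_isDiagonalAssignment,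
      fun n b h hb => ⟨H.exists_isEvenDistribution hb, fun owner ho =>
        ⟨fun p => (H.card_owned_mul ho p).trans h.symm, fun N D hND => ?_⟩⟩⟩
    obtain ⟨σ, E, hlen⟩ := H.exists_isExchange
    have hlen' : (σ.length : ℝ) = (q : ℝ) ^ 3 / 2 + 3 * (q : ℝ) ^ 2 / 2 - 1 := by
      have := congrArg (Nat.cast : ℕ → ℝ) hlen
      push_cast at this
      linarith
    have hg := H.card_gatherMsg ho
    have hr := H.card_reduceMsg ho
    let p₀ : Fin (q * (q ^ 2 + 1)) := ⟨0, Nat.mul_pos H.pos (Nat.succ_pos _)⟩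
    refine ⟨σ, σ, E.isSchedule, E.isSchedule, hlen', hlen', fun p => ?_, ?_, fun A x hA => ?_⟩
    · exact ⟨STTSV.IsExchange.cast_eq_costPerVector H h (E.wordsSent_mul H hg p),
        STTSV.IsExchange.cast_eq_costPerVector H h (E.wordsReceived_mul H hg p),
        STTSV.IsExchange.cast_eq_costPerVector H h (E.wordsSent_mul H hr p),
        STTSV.IsExchange.cast_eq_costPerVector H h (E.wordsReceived_mul H hr p)⟩
    · rw [E.bandwidthCost_eq H hg p₀, E.bandwidthCost_eq H hr p₀,
        STTSV.IsExchange.cast_eq_costPerVector H h (E.wordsReceived_mul H hg p₀),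
        STTSV.IsExchange.cast_eq_costPerVector H h (E.wordsReceived_mul H hr p₀)]
      ring
    · exact ⟨fun p i s => E.gatherX_eq h ho x p i s,
        fun i s => H.parallelSTTSV_owner h hND ho E E hA x i s⟩
  · obtain ⟨q₀, hq₀⟩ := exists_nat_ge (4 / ε)
    refine ⟨q₀, fun q hq hpp n hn hdvd => ?_⟩
    have hqε : 4 / ε ≤ q := hq₀.trans (by exact_mod_cast hq)
    have hqn : q ≤ n := Nat.le_of_dvd hn
      ((Dvd.intro _ (mul_assoc q (q + 1) (q ^ 2 + 1)).symm).trans hdvd)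
    exact ⟨STTSV.abs_costPerVector_sub_le hε hpp.two_le hqε,
      STTSV.abs_lowerBound_sub_le hε hpp.two_le hqε hqn⟩
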